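/- Let $w=(w_1,\dots,w_n)$ be positive real weights. Call a polynomial $p\in\mathbb{C}[x_1,\dots,x_n]$ with $p(0)=0$ quasihomogeneous of degree $d\in\mathbb{R}$ with respect to $w$ if every monomial $x_1^{k_1}\cdots x_n^{k_n}$ occurring in $p$ satisfies $w_1k_1+\cdots+w_nk_n=d$ (so $p=0$ is allowed). Let $\mathcal{O}_n$ be the ring of germs at $0$ of analytic functions on $\mathbb{C}^n$, and let $\theta_n$ be the free $\mathcal{O}_n$-module of germs at $0$ of analytic vector fields $\eta=\sum_i\eta_i\,\partial/\partial x_i$, acting on $\mathcal{O}_n$ by $\eta(h)=\sum_i\eta_i\,\partial h/\partial x_i$. For a set $V\subseteq\mathbb{C}^n$ let $I(V)\subseteq\mathcal{O}_n$ be the ideal of germs that vanish on $V$ near $0$, and put $$\Theta_V=\{\eta\in\theta_n:\eta(I(V))\subseteq I(V)\},\qquad \Theta_V^0=\{\eta\in\Theta_V:\eta(0)=0\},\qquad J_h(\Theta_V^0)=\{\eta(h):\eta\in\Theta_V^0\}\subseteq\mathcal{O}_n .$$ Two germs $h_1,h_2$ are called $\mathcal{R}_V$-equivalent if $h_1\circ\psi=h_2$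 for some germ of a biholomorphism $\psi:(\mathbb{C}^n,0)\to(\mathbb{C}^n,0)$ with $\psi(V)=V$ (as germs at $0$). Let $f,g$ be quasihomogeneous polynomials of the same degree $d$ with respect to $w$, let $\Phi$ be a quasihomogeneous polynomial of some degree $r$ with respect to the same weights, and let $V=\Phi^{-1}(0)$. If $J_f(\Theta_V^0)=J_g(\Theta_V^0)$, then $f$ and $g$ are $\mathcal{R}_V$-equivalent. -/

import Mathlib

open Topology

noncomputable section

namespace RelMilnor

/-- The affine space `ℂⁿ`. -/
abbrev Cn (n : ℕ) : Type := Fin n → ℂ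

/-- The ring `𝒪ₙ` of germs at `0` of analytic functions on `ℂⁿ`, as a subring of the ring of all
germs at `0` of complex-valued functions. -/
def O (n : ℕ) : Subring (Filter.Germ (𝓝 (0 : Cn n)) ℂ) where
  carrier := {h | ∃ F : Cn n → ℂ, AnalyticAt ℂ F 0 ∧ (F : Filter.Germ (𝓝 (0 : Cn n)) ℂ) = h}
  mul_mem' := by
    rintro _ _ ⟨F, hF, rfl⟩ ⟨G, hG, rfl⟩
    exact ⟨F * G, hF.mul hG, rfl⟩
  one_mem' := ⟨1, analyticAt_const, rfl⟩
  add_mem' := by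
    rintro _ _ ⟨F, hF, rfl⟩ ⟨G, hG, rfl⟩
    exact ⟨F + G, hF.add hG, rfl⟩
  zero_mem' := ⟨0, analyticAt_const, rfl⟩
  neg_mem' := by
    rintro _ ⟨F, hF, rfl⟩
    exact ⟨-F, hF.neg, rfl⟩

variable {n : ℕ}

/-- The germ at `0` of a function that is analytic at `0`. -/
def germ (F : Cn n → ℂ) (hF : AnalyticAt ℂ F 0) : O n := ⟨F, F, hF, rfl⟩

/-- The polynomial function on `ℂⁿ` given by a polynomial. -/
def polyFun (p : MvPolynomial (Fin n) ℂ) : Cn n → ℂ := fun x => MvPolynomial.eval x p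

theorem analyticAt_polyFun (p : MvPolynomial (Fin n) ℂ) (x : Cn n) :
    AnalyticAt ℂ (polyFun p) x :=
  AnalyticOnNhd.eval_mvPolynomial p x (Set.mem_univ x)

/-- The germ at `0` of a polynomial function. -/
def polyGerm (p : MvPolynomial (Fin n) ℂ) : O n := germ (polyFun p) (analyticAt_polyFun p 0)

/-- The partial derivative `∂F/∂xᵢ` of a function on `ℂⁿ`. -/
def partialFun (i : Fin n) (F : Cn n → ℂ) : Cn n → ℂ :=
  fun x => fderiv ℂ F x (Pi.single i 1)

theorem analyticAt_partialFun (i : Fin n) {F : Cn n → ℂ} {x : Cn n} (hF : AnalyticAt ℂ F x) :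
    AnalyticAt ℂ (partialFun i F) x :=
  ((ContinuousLinearMap.apply ℂ ℂ (Pi.single i (1 : ℂ) : Cn n)).analyticAt _).comp hF.fderiv

/-- The partial derivative `∂/∂xᵢ` on arbitrary germs at `0` (meaningful on `𝒪ₙ`). -/
def partialAux (i : Fin n) :
    Filter.Germ (𝓝 (0 : Cn n)) ℂ → Filter.Germ (𝓝 (0 : Cn n)) ℂ :=
  Filter.Germ.map' (partialFun i) fun F G (h : F =ᶠ[𝓝 0] G) => by
    filter_upwards [h.fderiv (𝕜 := ℂ)] with x hx
    simp only [partialFun, hx]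

/-- The partial derivative `∂/∂xᵢ : 𝒪ₙ → 𝒪ₙ`. -/
def partialD (i : Fin n) (h : O n) : O n :=
  ⟨partialAux i h.1, by
    obtain ⟨_, F, hF, rfl⟩ := h
    exact ⟨partialFun i F, analyticAt_partialFun i hF, rfl⟩⟩

theorem partialD_germ (i : Fin n) (F : Cn n → ℂ) (hF : AnalyticAt ℂ F 0) :
    partialD i (germ F hF) = germ (partialFun i F) (analyticAt_partialFun i hF) := rfl

/-- The `𝒪ₙ`-module `θₙ` of germs at `0` of analytic vector fields `∑ ηᵢ ∂/∂xᵢ`, free of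
rank `n`; the field is given by its components. -/
abbrev Theta (n : ℕ) : Type := Fin n → O n

/-- The differential `dh : θₙ → 𝒪ₙ`, `η ↦ η(h) = ∑ ηᵢ ∂h/∂xᵢ`. -/
def dGerm (h : O n) : Theta n →ₗ[O n] O n where
  toFun η := ∑ i, η i * partialD i h
  map_add' η ζ := by simp [add_mul, Finset.sum_add_distrib]
  map_smul' c η := by simp [mul_assoc, Finset.mul_sum]

/-- The ideal `I(V) ⊆ 𝒪ₙ` of germs vanishing on (the germ at `0` of) the set `V`. -/
def vanishingIdeal (V : Set (Cn n)) : Ideal (O n) where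
  carrier := {h | ∃ F : Cn n → ℂ, (F : Filter.Germ (𝓝 (0 : Cn n)) ℂ) = h.1 ∧
    ∀ᶠ x in 𝓝 (0 : Cn n), x ∈ V → F x = 0}
  add_mem' := by
    rintro h k ⟨F, hF, hF0⟩ ⟨G, hG, hG0⟩
    refine ⟨F + G, ?_, ?_⟩
    · rw [Subring.coe_add, ← hF, ← hG]; rfl
    · filter_upwards [hF0, hG0] with x h1 h2 hx
      simp [h1 hx, h2 hx]
  zero_mem' := ⟨0, rfl, Filter.Eventually.of_forall fun _ _ => rfl⟩
  smul_mem' := by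
    rintro ⟨_, G, hG, rfl⟩ k ⟨F, hF, hF0⟩
    refine ⟨G * F, ?_, ?_⟩
    · rw [smul_eq_mul, Subring.coe_mul, ← hF]; rfl
    · filter_upwards [hF0] with x h1 hx
      simp [h1 hx]

theorem germ_mem_vanishingIdeal (V : Set (Cn n)) (F : Cn n → ℂ) (hF : AnalyticAt ℂ F 0) :
    germ F hF ∈ vanishingIdeal V ↔ ∀ᶠ x in 𝓝 (0 : Cn n), x ∈ V → F x = 0 := by
  constructor
  · rintro ⟨G, hG, hG0⟩
    have hGF : G =ᶠ[𝓝 (0 : Cn n)] F := Filter.Germ.coe_eq.mp hG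
    filter_upwards [hG0, hGF] with x h1 h2 hx
    rw [← h2, h1 hx]
  · exact fun h => ⟨F, rfl, h⟩

/-- `Θ_V = {η ∈ θₙ : η(I(V)) ⊆ I(V)}`, the module of vector fields tangent to `V`. -/
def ThetaV (V : Set (Cn n)) : Submodule (O n) (Theta n) where
  carrier := {η | ∀ h ∈ vanishingIdeal V, dGerm h η ∈ vanishingIdeal V}
  add_mem' := by
    intro η ζ h1 h2 h hh
    rw [map_add]
    exact Ideal.add_mem _ (h1 h hh) (h2 h hh)
  zero_mem' := by
    intro h _
    rw [map_zero]
    exact Ideal.zero_mem _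
  smul_mem' := by
    intro c η h1 h hh
    rw [map_smul]
    exact Ideal.mul_mem_left _ c (h1 h hh)

/-- Evaluation of germs at the origin, `𝒪ₙ → ℂ`. -/
def evalZero (n : ℕ) : O n →+* ℂ := Filter.Germ.valueRingHom.comp (O n).subtype

theorem evalZero_germ (F : Cn n → ℂ) (hF : AnalyticAt ℂ F 0) :
    evalZero n (germ F hF) = F 0 := rfl

/-- `Θ_V⁰`, the submodule of the `η ∈ Θ_V` that are zero at zero. -/
def ThetaV0 (V : Set (Cn n)) : Submodule (O n) (Theta n) where
  carrier := {η | η ∈ ThetaV V ∧ ∀ i, evalZero n (η i) = 0}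
  add_mem' := by
    rintro η ζ ⟨h1, h2⟩ ⟨h3, h4⟩
    exact ⟨add_mem h1 h3, fun i => by simp [h2, h4]⟩
  zero_mem' := ⟨zero_mem _, fun i => by simp⟩
  smul_mem' := by
    rintro c η ⟨h1, h2⟩
    exact ⟨Submodule.smul_mem _ c h1, fun i => by simp [h2]⟩

/-- `J_h(M) = dh(M) = {η(h) : η ∈ M}`, an ideal of `𝒪ₙ`, for a submodule `M` of `θₙ`. -/
def J (h : O n) (M : Submodule (O n) (Theta n)) : Ideal (O n) := Submodule.map (dGerm h) M

/-- `e` represents an element of the group `𝓡_V`: it is a biholomorphism between two open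
neighbourhoods of `0` that fixes `0` and maps the part of `V` in the first onto the part of `V`
in the second. -/
structure IsRV (V : Set (Cn n)) (e : OpenPartialHomeomorph (Cn n) (Cn n)) : Prop where
  zero_mem : 0 ∈ e.source
  map_zero : e 0 = 0
  analytic : AnalyticOnNhd ℂ e e.source
  analytic_symm : AnalyticOnNhd ℂ e.symm e.target
  image_eq : e '' (V ∩ e.source) = V ∩ e.target

/-- `𝓡_V`-equivalence of (the germs at `0` of) two functions: `h₁ ∘ ψ = h₂` for some
`ψ ∈ 𝓡_V`. -/
def RVEquiv (V : Set (Cn n)) (h₁ h₂ : Cn n → ℂ) : Prop :=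
  ∃ e : OpenPartialHomeomorph (Cn n) (Cn n), IsRV V e ∧ h₁ ∘ e =ᶠ[𝓝 0] h₂

/-- The set `H_w^d(n,1;ℂ)` of quasihomogeneous polynomials `(ℂⁿ,0) → (ℂ,0)` of degree `d` with
weights `w`: the exponents `k` of all nonzero terms satisfy `∑ wᵢ kᵢ = d`, and the constant term
is zero. -/
def IsQuasihomogeneous (w : Fin n → ℝ) (d : ℝ) (p : MvPolynomial (Fin n) ℂ) : Prop :=
  MvPolynomial.IsWeightedHomogeneous w p d ∧ MvPolynomial.constantCoeff p = 0

/-- The zero set `p⁻¹(0) ⊆ ℂⁿ`. -/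
def zeroSet (p : MvPolynomial (Fin n) ℂ) : Set (Cn n) := polyFun p ⁻¹' {0}

end RelMilnor

end

/-!
The idea is a homotopy argument in the pencil `h_t = (1 - t) f + t g`, carried out with vector
fields of weight zero.

The zero set `V` of `Φ` is invariant under the weighted scalings `x ↦ (e^{s wᵢ} xᵢ)`. Letting
`s → -∞` shows that the weighted components of a jet of a function vanishing on `V` also vanish on
`V` (`polyFun_component_eq_zero`). Consequently, if `L` denotes the space of weight-zero parts of the
fields in `Θ_V⁰`, then `L` maps the quasihomogeneous polynomials of degree `r` that vanish on `V` to
such polynomials (`polyFun_lieDeriv_eq_zero`), and comparing terms of degree `d` in the equality of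
the two ideals gives `L f = L g` (`exists_lieDeriv_eq`). Call this finite-dimensional space `W`. The
Euler field lies in `L`, so `f` and `g` lie in `W` when `d ≠ 0`; when `d = 0` both are zero.

Now `L h_t ⊆ W` for all `t`, with equality for all but finitely many `t`, among which are neither `0`
nor `1` (`finite_not_surjective_pencil`). The remaining `t` form a connected set, so it is enough
to show that `h_t` and `h_{t₀}` are equivalent for `t` near a point `t₀` of this set. There one can
solve `η_t(h_t) = g - f` with `η_t` in `L` depending continuously on `t`
(`exists_continuous_solution`), and `h_t` is constant along the flow of the time-dependent field
`-η_t` (`eventually_rvEquiv`).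

That the flow is a biholomorphism is seen without smooth dependence on initial conditions. A field of
weight zero acts linearly on the span of the monomials of bounded weighted degree, so under the
monomial map `ℂⁿ → ℂ^ι` it becomes a linear vector field, and the flow is read off from a fundamental
matrix (`exists_linearizable_flow`): it is polynomial in `x`. The image of `V` is cut out by a linear
subspace invariant under the linear fields (`linearAction_mem_cutOut`), hence by uniqueness for
linear equations the flow preserves `V` in both directions.
-/

noncomputable section

namespace RelMilnor

variable {n : ℕ}

open MvPolynomial Filter Asymptotics

/-! ### Polynomial vector fields and weighted degrees -/

theorem hasFDerivAt_polyFun (p : MvPolynomial (Fin n) ℂ) (x : Cn n) :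
    HasFDerivAt (polyFun p)
      (∑ i, polyFun (pderiv i p) x • (ContinuousLinearMap.proj i : Cn n →L[ℂ] ℂ)) x := by
  classical
  induction p using MvPolynomial.induction_on with
  | C a =>
    have : polyFun (C a : MvPolynomial (Fin n) ℂ) = fun _ => a := by ext; simp [polyFun]
    rw [this]
    exact (hasFDerivAt_const a x).congr_fderiv (by ext; simp [polyFun])
  | add p q hp hq =>
    have : polyFun (p + q) = fun y => polyFun p y + polyFun q y := by ext; simp [polyFun]
    rw [this]
    exact (hp.add hq).congr_fderiv (by ext; simp [polyFun, add_mul, Finset.sum_add_distrib])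
  | mul_X p i hp =>
    have : polyFun (p * X i) = fun y => polyFun p y * y i := by ext; simp [polyFun]
    rw [this]
    have h2 : HasFDerivAt (fun y : Cn n => y i) (ContinuousLinearMap.proj i : Cn n →L[ℂ] ℂ) x :=
      hasFDerivAt_apply i x
    refine (hp.mul h2).congr_fderiv (ContinuousLinearMap.ext fun v => ?_)
    have h3 : ∑ j, eval x p * eval x ((Pi.single j 1 : Fin n → MvPolynomial (Fin n) ℂ) i) * v j =
        eval x p * v i := by
      rw [Finset.sum_eq_single i]
      · simp
      · intro j _ hj
        simp [hj.symm]
      · simp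
    simp only [polyFun, pderiv_mul, map_add, map_mul, pderiv_X, eval_X, _root_.sum_apply,
      _root_.add_apply, _root_.smul_apply, ContinuousLinearMap.proj_apply,
      smul_eq_mul, add_mul, Finset.sum_add_distrib, Finset.mul_sum, h3]
    rw [add_comm]
    congr 1
    exact Finset.sum_congr rfl fun j _ => by ring

theorem partialFun_polyFun (i : Fin n) (p : MvPolynomial (Fin n) ℂ) :
    partialFun i (polyFun p) = polyFun (pderiv i p) := by
  classical
  ext x
  simp [partialFun, (hasFDerivAt_polyFun p x).fderiv, Pi.single_apply]

/-- The derivative `∑ ξᵢ ∂P/∂xᵢ` of a polynomial along a polynomial vector field, as a linear map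
in the polynomial and in the field. -/
def lieDeriv : (Fin n → MvPolynomial (Fin n) ℂ) →ₗ[ℂ]
    MvPolynomial (Fin n) ℂ →ₗ[ℂ] MvPolynomial (Fin n) ℂ :=
  LinearMap.mk₂ ℂ (fun ξ P => ∑ i, ξ i * pderiv i P)
    (fun ξ ζ P => by simp [add_mul, Finset.sum_add_distrib])
    (fun c ξ P => by simp [Finset.smul_sum])
    (fun ξ P Q => by simp [mul_add, Finset.sum_add_distrib])
    (fun c ξ P => by simp [Finset.smul_sum])

theorem lieDeriv_apply (ξ : Fin n → MvPolynomial (Fin n) ℂ) (P : MvPolynomial (Fin n) ℂ) :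
    lieDeriv ξ P = ∑ i, ξ i * pderiv i P := rfl

theorem polyFun_lieDeriv (ξ : Fin n → MvPolynomial (Fin n) ℂ) (P : MvPolynomial (Fin n) ℂ)
    (x : Cn n) : polyFun (lieDeriv ξ P) x = ∑ i, polyFun (ξ i) x * polyFun (pderiv i P) x := by
  simp [lieDeriv_apply, polyFun]

theorem lieDeriv_X (ξ : Fin n → MvPolynomial (Fin n) ℂ) (i : Fin n) : lieDeriv ξ (X i) = ξ i := by
  rw [lieDeriv_apply, Finset.sum_eq_single i]
  · simp
  · intro l _ hl
    simp [pderiv_X_of_ne hl.symm]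
  · simp

theorem isWeightedHomogeneous_lieDeriv {w : Fin n → ℝ} {δ : ℝ}
    {ξ : Fin n → MvPolynomial (Fin n) ℂ} (hξ : ∀ i, IsWeightedHomogeneous w (ξ i) (w i))
    {P : MvPolynomial (Fin n) ℂ} (hP : IsWeightedHomogeneous w P δ) :
    IsWeightedHomogeneous w (lieDeriv ξ P) δ := by
  refine IsWeightedHomogeneous.sum _ _ _ fun i _ => ?_
  have := (hξ i).mul (hP.pderiv (i := i) (n' := δ - w i) (by ring))
  rwa [add_sub_cancel] at this

theorem weightedHomogeneousComponent_mul_of_isWeightedHomogeneous {w : Fin n → ℝ} {b : ℝ}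
    {P : MvPolynomial (Fin n) ℂ} (hP : IsWeightedHomogeneous w P b) (δ : ℝ)
    (q : MvPolynomial (Fin n) ℂ) :
    weightedHomogeneousComponent w δ (q * P) = weightedHomogeneousComponent w (δ - b) q * P := by
  classical
  induction q using MvPolynomial.induction_on' with
  | monomial m a =>
    have h : IsWeightedHomogeneous w (monomial m a) (Finsupp.weight w m) :=
      isWeightedHomogeneous_monomial w m a rfl
    have h2 := h.mul hP
    rw [weightedHomogeneousComponent_of_mem h, weightedHomogeneousComponent_of_mem h2]
    by_cases hc : δ = Finsupp.weight w m + b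
    · rw [if_pos hc, if_pos (by rw [hc]; ring)]
    · rw [if_neg hc, if_neg (fun h3 => hc (by rw [← h3]; ring)), zero_mul]
  | add p q hp hq => rw [add_mul, map_add, map_add, hp, hq, add_mul]

/-- Euler's identity for real weights. -/
theorem lieDeriv_euler {w : Fin n → ℝ} {δ : ℝ} {P : MvPolynomial (Fin n) ℂ}
    (hP : IsWeightedHomogeneous w P δ) :
    lieDeriv (fun i => C (w i : ℂ) * X i) P = C (δ : ℂ) * P := by
  classical
  have hmon : ∀ (m : Fin n →₀ ℕ) (a : ℂ), lieDeriv (fun i => C (w i : ℂ) * X i) (monomial m a) =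
      C ((Finsupp.weight w m : ℝ) : ℂ) * monomial m a := by
    intro m a
    simp only [lieDeriv_apply, C_mul', smul_mul_assoc, X_mul_pderiv_monomial,
      Finsupp.weight_eq_sum, ← Nat.cast_smul_eq_nsmul ℂ, smul_smul, ← Finset.sum_smul]
    congr 1
    push_cast
    exact Finset.sum_congr rfl fun i _ => by simp [mul_comm]
  ext m
  conv_lhs => rw [P.as_sum, map_sum]
  conv_rhs => rw [P.as_sum, Finset.mul_sum]
  congr 1
  refine Finset.sum_congr rfl fun k hk => ?_
  rw [hmon, hP (mem_support_iff.mp hk)]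

/-! ### Jets of analytic functions and weighted scalings -/

/-- The polynomial `q` agrees with `F` at `0` modulo terms of order `N`: `F - q = O(‖x‖ᴺ)`. -/
def IsJet (N : ℕ) (F : Cn n → ℂ) (q : MvPolynomial (Fin n) ℂ) : Prop :=
  (fun x => F x - polyFun q x) =O[𝓝 0] fun x => ‖x‖ ^ N

namespace IsJet

variable {N : ℕ} {F G : Cn n → ℂ} {p q : MvPolynomial (Fin n) ℂ}

theorem refl (N : ℕ) (q : MvPolynomial (Fin n) ℂ) : IsJet N (polyFun q) q := by
  simpa [IsJet] using isBigO_zero (fun x : Cn n => ‖x‖ ^ N) _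

theorem add (hF : IsJet N F p) (hG : IsJet N G q) : IsJet N (F + G) (p + q) := by
  refine (IsBigO.add hF hG).congr_left fun x => ?_
  simp [polyFun]; ring

theorem mul_polyFun (hF : IsJet N F p) (q : MvPolynomial (Fin n) ℂ) :
    IsJet N (F * polyFun q) (p * q) := by
  have h1 : polyFun q =O[𝓝 (0 : Cn n)] fun _ => (1 : ℝ) :=
    (analyticAt_polyFun q 0).continuousAt.norm.isBoundedUnder_le.isBigO_one ℝ
  refine (IsBigO.mul hF h1).congr (fun x => ?_) fun x => by simp
  simp [polyFun]; ring

theorem sum {ι : Type*} (s : Finset ι) {F : ι → Cn n → ℂ} {q : ι → MvPolynomial (Fin n) ℂ}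
    (h : ∀ i ∈ s, IsJet N (F i) (q i)) : IsJet N (∑ i ∈ s, F i) (∑ i ∈ s, q i) := by
  classical
  induction s using Finset.induction_on with
  | empty => simpa [IsJet, polyFun] using isBigO_zero (fun x : Cn n => ‖x‖ ^ N) _
  | insert a s ha ih =>
    rw [Finset.sum_insert ha, Finset.sum_insert ha]
    exact (h a (by simp)).add (ih fun i hi => h i (by simp [hi]))

theorem congr (hF : IsJet N F p) (h : F =ᶠ[𝓝 0] G) : IsJet N G p :=
  IsBigO.congr' hF (h.mono fun x hx => by simp [hx]) EventuallyEq.rfl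

end IsJet

/-- The homogeneous terms of a power series in `n` variables are polynomials in the coordinates. -/
theorem exists_polyFun_eq_multilinear {k : ℕ} (T : (Cn n) [×k]→L[ℂ] ℂ) :
    ∃ q : MvPolynomial (Fin n) ℂ, ∀ y, T (fun _ => y) = polyFun q y := by
  classical
  refine ⟨∑ r : Fin k → Fin n, C (T fun j => Pi.single (r j) 1) * ∏ j, X (r j), fun y => ?_⟩
  have hy : (fun _ : Fin k => y) = fun _ => ∑ i, y i • (Pi.single i (1 : ℂ) : Cn n) := by
    ext _ i
    simp [Finset.sum_apply, Pi.single_apply]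
  rw [hy, T.map_sum]
  simp only [polyFun, map_sum, map_mul, eval_C, map_prod, eval_X]
  refine Finset.sum_congr rfl fun r _ => ?_
  rw [T.map_smul_univ, smul_eq_mul, mul_comm]

theorem exists_isJet {F : Cn n → ℂ} (hF : AnalyticAt ℂ F 0) (N : ℕ) : ∃ q, IsJet N F q := by
  obtain ⟨p, hp⟩ := hF
  choose q hq using fun k => exists_polyFun_eq_multilinear (p k)
  refine ⟨∑ k ∈ Finset.range N, q k, ?_⟩
  refine (hp.isBigO_sub_partialSum_pow N).congr_left fun y => ?_
  simp [FormalMultilinearSeries.partialSum, hq, polyFun]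

/-- The weighted scaling `x ↦ (e^{s wᵢ} xᵢ)`. -/
def wscale (w : Fin n → ℝ) (s : ℝ) (x : Cn n) : Cn n := fun i => (Real.exp (s * w i) : ℂ) * x i

theorem prod_wscale (w : Fin n → ℝ) (s : ℝ) (x : Cn n) (k : Fin n →₀ ℕ) :
    ∏ i, wscale w s x i ^ k i = (Real.exp (s * Finsupp.weight w k) : ℂ) * ∏ i, x i ^ k i := by
  simp only [wscale, mul_pow, Finset.prod_mul_distrib, Finsupp.weight_eq_sum, Finset.mul_sum,
    Real.exp_sum, nsmul_eq_mul]
  push_cast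
  congr 1
  refine Finset.prod_congr rfl fun i _ => ?_
  rw [← Complex.exp_nat_mul]
  congr 1; ring

theorem polyFun_wscale {w : Fin n → ℝ} {δ : ℝ} {P : MvPolynomial (Fin n) ℂ}
    (hP : IsWeightedHomogeneous w P δ) (s : ℝ) (x : Cn n) :
    polyFun P (wscale w s x) = (Real.exp (s * δ) : ℂ) * polyFun P x := by
  simp only [polyFun, eval_eq', Finset.mul_sum]
  refine Finset.sum_congr rfl fun k hk => ?_
  rw [prod_wscale, hP (mem_support_iff.mp hk)]
  ring

theorem polyFun_wscale_eq_sum (w : Fin n → ℝ) (q : MvPolynomial (Fin n) ℂ) (s : ℝ) (x : Cn n) :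
    polyFun q (wscale w s x) = ∑ a ∈ q.support.image (Finsupp.weight w),
      polyFun (weightedHomogeneousComponent w a q) x * (Real.exp (s * a) : ℂ) := by
  classical
  have h1 : polyFun q (wscale w s x) =
      ∑ k ∈ q.support, coeff k q * (Real.exp (s * Finsupp.weight w k) * ∏ i, x i ^ k i) := by
    simp only [polyFun, eval_eq', prod_wscale]
  rw [h1, ← Finset.sum_fiberwise_of_maps_to
    (fun k hk => Finset.mem_image_of_mem (Finsupp.weight w) hk)]
  refine Finset.sum_congr rfl fun a _ => ?_
  rw [weightedHomogeneousComponent_apply]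
  simp only [polyFun, map_sum, eval_monomial, Finset.sum_mul]
  refine Finset.sum_congr rfl fun k hk => ?_
  rw [(Finset.mem_filter.mp hk).2, Finsupp.prod_fintype _ _ (by simp)]
  ring

/-- An exponential sum that is `O(e^{bs})` as `s → -∞` has no terms of exponent less than `b`. -/
theorem eq_zero_of_sum_exp_isBigO (S : Finset ℝ) (c : ℝ → ℂ) (b : ℝ)
    (h : (fun s : ℝ => ∑ a ∈ S, c a * (Real.exp (s * a) : ℂ)) =O[atBot]
      fun s => Real.exp (s * b)) : ∀ a ∈ S, a < b → c a = 0 := by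
  induction S using Finset.induction_on_min with
  | empty => simp
  | insert m S hm ih =>
    have hmS : m ∉ S := fun h => lt_irrefl _ (hm m h)
    by_cases hb : m < b
    · have hexp : ∀ r : ℝ, 0 < r → Tendsto (fun s : ℝ => Real.exp (s * r)) atBot (𝓝 0) :=
        fun r hr => Real.tendsto_exp_atBot.comp (tendsto_id.atBot_mul_const hr)
      have hc : c m = 0 := by
        -- after division by `e^{ms}` every term but the first tends to `0`
        have h1 : Tendsto (fun s : ℝ => (Real.exp (-(s * m)) : ℂ) *
            ∑ a ∈ insert m S, c a * (Real.exp (s * a) : ℂ)) atBot (𝓝 0) := by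
          have h2 : (fun s : ℝ => (Real.exp (-(s * m)) : ℂ) *
              ∑ a ∈ insert m S, c a * (Real.exp (s * a) : ℂ)) =O[atBot]
              fun s => Real.exp (s * (b - m)) := by
            have h3 : (fun s : ℝ => (Real.exp (-(s * m)) : ℂ)) =O[atBot]
                fun s => Real.exp (-(s * m)) :=
              IsBigO.of_bound 1 (Eventually.of_forall fun s => by
                rw [Complex.norm_real, one_mul])
            refine (h3.mul h).congr_right fun s => ?_
            rw [← Real.exp_add]
            congr 1; ring
          exact h2.trans_tendsto (hexp _ (sub_pos.mpr hb))
        have h4 : Tendsto (fun s : ℝ => (Real.exp (-(s * m)) : ℂ) *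
            ∑ a ∈ insert m S, c a * (Real.exp (s * a) : ℂ)) atBot
            (𝓝 (c m + ∑ a ∈ S, c a * ((0 : ℝ) : ℂ))) := by
          have h5 : (fun s : ℝ => (Real.exp (-(s * m)) : ℂ) *
              ∑ a ∈ insert m S, c a * (Real.exp (s * a) : ℂ)) =
              fun s => c m + ∑ a ∈ S, c a * (Real.exp (s * (a - m)) : ℂ) := by
            ext s
            have h6 : ∀ a, (Real.exp (-(s * m)) : ℂ) * (c a * (Real.exp (s * a) : ℂ)) =
                c a * (Real.exp (s * (a - m)) : ℂ) := fun a => by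
              rw [mul_left_comm, ← Complex.ofReal_mul, ← Real.exp_add]
              congr 3; ring
            rw [Finset.mul_sum, Finset.sum_insert hmS, h6]
            simp only [h6, sub_self, mul_zero, Real.exp_zero, Complex.ofReal_one, mul_one]
          rw [h5]
          refine tendsto_const_nhds.add (tendsto_finsetSum _ fun a ha => ?_)
          exact tendsto_const_nhds.mul
            ((Complex.continuous_ofReal.tendsto _).comp (hexp _ (sub_pos.mpr (hm a ha))))
        simpa using tendsto_nhds_unique h4 h1
      have h' := ih (by simpa [Finset.sum_insert hmS, hc] using h)
      intro a ha hab
      rcases Finset.mem_insert.mp ha with rfl | ha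
      · exact hc
      · exact h' a ha hab
    · intro a ha hab
      rcases Finset.mem_insert.mp ha with rfl | ha
      · exact absurd hab hb
      · exact absurd ((hm a ha).trans hab) hb

theorem norm_wscale_le {w : Fin n → ℝ} {m : ℝ} (hm : ∀ i, m ≤ w i) {s : ℝ} (hs : s ≤ 0)
    (x : Cn n) : ‖wscale w s x‖ ≤ Real.exp (s * m) * ‖x‖ := by
  refine (pi_norm_le_iff_of_nonneg (by positivity)).mpr fun i => ?_
  rw [wscale, norm_mul, Complex.norm_real, Real.norm_of_nonneg (Real.exp_pos _).le]
  exact mul_le_mul (Real.exp_le_exp.mpr (mul_le_mul_of_nonpos_left (hm i) hs))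
    (norm_le_pi_norm x i) (norm_nonneg _) (Real.exp_pos _).le

theorem tendsto_wscale {w : Fin n → ℝ} (hw : ∀ i, 0 < w i) (x : Cn n) :
    Tendsto (fun s => wscale w s x) atBot (𝓝 0) := by
  refine tendsto_pi_nhds.mpr fun i => ?_
  have h : Tendsto (fun s : ℝ => ((Real.exp (s * w i) : ℝ) : ℂ)) atBot (𝓝 ((0 : ℝ) : ℂ)) :=
    (Complex.continuous_ofReal.tendsto _).comp
      (Real.tendsto_exp_atBot.comp (tendsto_id.atBot_mul_const (hw i)))
  simpa [wscale] using h.mul_const (x i)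

/-- The low weighted components of a jet of a function that vanishes near `0` on a set invariant
under the weighted scalings vanish on that set. -/
theorem polyFun_component_eq_zero {w : Fin n → ℝ} (hw : ∀ i, 0 < w i) {m : ℝ}
    (hm : ∀ i, m ≤ w i) {V : Set (Cn n)} (hV : ∀ s, ∀ x ∈ V, wscale w s x ∈ V) {F : Cn n → ℂ}
    (hF : ∀ᶠ x in 𝓝 (0 : Cn n), x ∈ V → F x = 0) {N : ℕ} {q : MvPolynomial (Fin n) ℂ}
    (hq : IsJet N F q) {δ : ℝ} (hδ : δ < N * m) {x : Cn n} (hx : x ∈ V) :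
    polyFun (weightedHomogeneousComponent w δ q) x = 0 := by
  classical
  have hlim := tendsto_wscale hw x
  have h1 : (fun s => polyFun q (wscale w s x)) =O[atBot] fun s => Real.exp (s * (N * m)) := by
    have h2 : (fun s => F (wscale w s x) - polyFun q (wscale w s x)) =O[atBot]
        fun s => ‖wscale w s x‖ ^ N := IsBigO.comp_tendsto hq hlim
    have h3 : (fun s => ‖wscale w s x‖ ^ N) =O[atBot] fun s => Real.exp (s * (N * m)) := by
      refine IsBigO.of_bound (‖x‖ ^ N) ?_
      filter_upwards [eventually_le_atBot 0] with s hs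
      rw [norm_pow, norm_norm, Real.norm_of_nonneg (Real.exp_pos _).le]
      calc ‖wscale w s x‖ ^ N ≤ (Real.exp (s * m) * ‖x‖) ^ N := by
            gcongr; exact norm_wscale_le hm hs x
        _ = _ := by
            rw [mul_pow, ← Real.exp_nat_mul, mul_comm]
            congr 2; ring
    refine ((h2.trans h3).neg_left).congr' ?_ EventuallyEq.rfl
    filter_upwards [hlim.eventually hF] with s hs
    rw [hs (hV s x hx)]; ring
  simp only [polyFun_wscale_eq_sum] at h1
  have h4 := eq_zero_of_sum_exp_isBigO _
    (fun a => polyFun (weightedHomogeneousComponent w a q) x) _ h1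
  by_cases hmem : δ ∈ q.support.image (Finsupp.weight w)
  · exact h4 δ hmem hδ
  · have h5 : weightedHomogeneousComponent w δ q = 0 :=
      weightedHomogeneousComponent_eq_zero' _ _ fun k hk h =>
        hmem (Finset.mem_image.mpr ⟨k, hk, h⟩)
    simp [h5, polyFun]

/-! ### The weight-zero part of the tangent fields -/

theorem exists_rep (η : Theta n) : ∃ F : Fin n → Cn n → ℂ, (∀ i, AnalyticAt ℂ (F i) 0) ∧
    ∀ i, (F i : Germ (𝓝 (0 : Cn n)) ℂ) = (η i).1 := by
  choose F hF h using fun i => (η i).2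
  exact ⟨F, hF, h⟩

theorem coe_dGerm_germ {η : Theta n} {F : Fin n → Cn n → ℂ}
    (hF : ∀ i, (F i : Germ (𝓝 (0 : Cn n)) ℂ) = (η i).1) (G : Cn n → ℂ) (hG : AnalyticAt ℂ G 0) :
    (dGerm (germ G hG) η).1 =
      ((∑ i, F i * partialFun i G : Cn n → ℂ) : Germ (𝓝 (0 : Cn n)) ℂ) := by
  have h1 : (dGerm (germ G hG) η).1 =
      ∑ i, (F i : Germ (𝓝 (0 : Cn n)) ℂ) * (partialFun i G : Cn n → ℂ) := by
    simp only [hF]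
    exact map_sum (O n).subtype _ _
  rw [h1]
  exact (map_sum (Germ.coeRingHom (𝓝 (0 : Cn n)) (R := ℂ)) (fun i => F i * partialFun i G)
    Finset.univ).symm

theorem coe_dGerm_polyGerm {η : Theta n} {F : Fin n → Cn n → ℂ}
    (hF : ∀ i, (F i : Germ (𝓝 (0 : Cn n)) ℂ) = (η i).1) (P : MvPolynomial (Fin n) ℂ) :
    (dGerm (polyGerm P) η).1 =
      ((∑ i, F i * polyFun (pderiv i P) : Cn n → ℂ) : Germ (𝓝 (0 : Cn n)) ℂ) := by
  simp only [← partialFun_polyFun]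
  exact coe_dGerm_germ hF (polyFun P) (analyticAt_polyFun P 0)

theorem mem_vanishingIdeal_iff {V : Set (Cn n)} {h : O n} {F : Cn n → ℂ}
    (hF : h.1 = (F : Germ (𝓝 (0 : Cn n)) ℂ)) :
    h ∈ vanishingIdeal V ↔ ∀ᶠ x in 𝓝 (0 : Cn n), x ∈ V → F x = 0 := by
  constructor
  · rintro ⟨G, hG, hG0⟩
    have hGF : G =ᶠ[𝓝 (0 : Cn n)] F := Germ.coe_eq.mp (hG.trans hF)
    filter_upwards [hG0, hGF] with x h1 h2 hx
    rw [← h2, h1 hx]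
  · exact fun h => ⟨F, hF.symm, h⟩

/-- The weight-zero parts `∑ ξᵢ ∂/∂xᵢ`, with `ξᵢ` weighted homogeneous of degree `wᵢ`, of the
vector fields in `Θ_V⁰`. The components `ξᵢ` are read off from jets of order `N`; a field determines
them only when `N` is large with respect to the weights. -/
def weightZeroPart (w : Fin n → ℝ) (V : Set (Cn n)) (N : ℕ) :
    Submodule ℂ (Fin n → MvPolynomial (Fin n) ℂ) where
  carrier := {ξ | ∃ η ∈ ThetaV0 V, ∃ (F : Fin n → Cn n → ℂ) (q : Fin n → MvPolynomial (Fin n) ℂ),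
    (∀ i, (F i : Germ (𝓝 (0 : Cn n)) ℂ) = (η i).1) ∧ (∀ i, IsJet N (F i) (q i)) ∧
    ∀ i, ξ i = weightedHomogeneousComponent w (w i) (q i)}
  add_mem' := by
    rintro _ _ ⟨η, hη, F, q, hF, hq, h⟩ ⟨η', hη', F', q', hF', hq', h'⟩
    refine ⟨η + η', add_mem hη hη', F + F', q + q', fun i => ?_, fun i => (hq i).add (hq' i),
      fun i => by simp [h, h']⟩
    rw [Pi.add_apply, Pi.add_apply, Subring.coe_add, ← hF, ← hF']; rfl
  zero_mem' := by
    refine ⟨0, zero_mem _, 0, 0, fun i => rfl, fun i => ?_, fun i => by simp⟩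
    exact (IsJet.refl N 0).congr (Eventually.of_forall fun x => by simp [polyFun])
  smul_mem' := by
    rintro c _ ⟨η, hη, F, q, hF, hq, h⟩
    refine ⟨germ (fun _ => c) analyticAt_const • η, Submodule.smul_mem _ _ hη, c • F, c • q,
      fun i => ?_, fun i => ?_, fun i => by simp [h]⟩
    · rw [Pi.smul_apply, Pi.smul_apply, smul_eq_mul, Subring.coe_mul, ← hF]; rfl
    · refine (IsBigO.const_mul_left (hq i) c).congr_left fun x => ?_
      simp [polyFun, mul_sub]

section

variable {w : Fin n → ℝ} {V : Set (Cn n)} {N : ℕ}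

theorem isWeightedHomogeneous_of_mem_weightZeroPart {ξ : Fin n → MvPolynomial (Fin n) ℂ}
    (hξ : ξ ∈ weightZeroPart w V N) (i : Fin n) : IsWeightedHomogeneous w (ξ i) (w i) := by
  obtain ⟨η, hη, F, q, hF, hq, h⟩ := hξ
  rw [h]
  exact weightedHomogeneousComponent_isWeightedHomogeneous _ _

/-- The degree `δ` part of `η(P)`, for `P` of degree `δ`, only involves the weight-zero part of
`η`. -/
theorem component_sum_mul_pderiv {δ : ℝ} {ξ q : Fin n → MvPolynomial (Fin n) ℂ}
    (h : ∀ i, ξ i = weightedHomogeneousComponent w (w i) (q i)) {P : MvPolynomial (Fin n) ℂ}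
    (hP : IsWeightedHomogeneous w P δ) :
    weightedHomogeneousComponent w δ (∑ i, q i * pderiv i P) = lieDeriv ξ P := by
  rw [map_sum, lieDeriv_apply]
  refine Finset.sum_congr rfl fun i _ => ?_
  rw [weightedHomogeneousComponent_mul_of_isWeightedHomogeneous
    (hP.pderiv (i := i) (n' := δ - w i) (by ring)), sub_sub_cancel, h]

/-- A weight-zero part of a field in `Θ_V⁰` maps homogeneous polynomials that vanish on `V` to
polynomials that vanish on `V`. -/
theorem polyFun_lieDeriv_eq_zero (hw : ∀ i, 0 < w i) {m : ℝ} (hm : ∀ i, m ≤ w i)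
    (hV : ∀ s, ∀ x ∈ V, wscale w s x ∈ V) {ξ : Fin n → MvPolynomial (Fin n) ℂ}
    (hξ : ξ ∈ weightZeroPart w V N) {δ : ℝ} (hδ : δ < N * m) {P : MvPolynomial (Fin n) ℂ}
    (hP : IsWeightedHomogeneous w P δ) (hPV : ∀ x ∈ V, polyFun P x = 0) :
    ∀ x ∈ V, polyFun (lieDeriv ξ P) x = 0 := by
  obtain ⟨η, hη, F, q, hF, hq, h⟩ := hξ
  have h1 : dGerm (polyGerm P) η ∈ vanishingIdeal V :=
    hη.1 _ ((germ_mem_vanishingIdeal V _ _).mpr (Eventually.of_forall hPV))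
  rw [mem_vanishingIdeal_iff (coe_dGerm_polyGerm hF P)] at h1
  have h2 := IsJet.sum Finset.univ fun i _ => (hq i).mul_polyFun (pderiv i P)
  intro x hx
  rw [← component_sum_mul_pderiv h hP]
  exact polyFun_component_eq_zero hw hm hV h1 h2 hδ hx

/-- The terms of degree `d` in the inclusion `J_f(Θ_V⁰) ⊆ J_g(Θ_V⁰)`. -/
theorem exists_lieDeriv_eq (hw : ∀ i, 0 < w i) {m : ℝ} (hm : ∀ i, m ≤ w i)
    {ξ : Fin n → MvPolynomial (Fin n) ℂ} (hξ : ξ ∈ weightZeroPart w V N) {d : ℝ} (hd : d < N * m)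
    {f g : MvPolynomial (Fin n) ℂ} (hf : IsWeightedHomogeneous w f d)
    (hg : IsWeightedHomogeneous w g d)
    (hJ : J (polyGerm f) (ThetaV0 V) ≤ J (polyGerm g) (ThetaV0 V)) :
    ∃ ξ' ∈ weightZeroPart w V N, lieDeriv ξ' g = lieDeriv ξ f := by
  obtain ⟨η, hη, F, q, hF, hq, h⟩ := hξ
  obtain ⟨η', hη', heq⟩ := hJ (Submodule.mem_map_of_mem (f := dGerm (polyGerm f)) hη)
  obtain ⟨F', hF'a, hF'⟩ := exists_rep η'
  choose q' hq' using fun i => exists_isJet (hF'a i) N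
  refine ⟨fun i => weightedHomogeneousComponent w (w i) (q' i),
    ⟨η', hη', F', q', hF', hq', fun i => rfl⟩, ?_⟩
  have h1 := coe_dGerm_polyGerm hF' g
  rw [heq, coe_dGerm_polyGerm hF f] at h1
  have h2 : (∑ i, F i * polyFun (pderiv i f) : Cn n → ℂ) =ᶠ[𝓝 0]
      ∑ i, F' i * polyFun (pderiv i g) := Germ.coe_eq.mp h1
  have h3 := IsJet.sum Finset.univ fun i _ => (hq i).mul_polyFun (pderiv i f)
  have h4 := (IsJet.sum Finset.univ fun i _ => (hq' i).mul_polyFun (pderiv i g)).congr h2.symm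
  -- the difference of the two jets is a jet of the zero function
  have h5 : IsJet N (fun _ => 0) (∑ i, q' i * pderiv i g - ∑ i, q i * pderiv i f) := by
    refine (IsBigO.sub h4 h3).congr_left fun x => ?_
    simp [polyFun]
  have h6 : weightedHomogeneousComponent w d
      (∑ i, q' i * pderiv i g - ∑ i, q i * pderiv i f) = 0 :=
    MvPolynomial.funext fun x => by
      simpa [polyFun] using polyFun_component_eq_zero hw hm (V := Set.univ) (fun _ _ _ => trivial)
        (Eventually.of_forall fun _ _ => rfl) h5 hd (Set.mem_univ x)
  rwa [map_sub, component_sum_mul_pderiv (fun i => rfl) hg, component_sum_mul_pderiv h hf,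
    sub_eq_zero] at h6

theorem hasDerivAt_wscale (w : Fin n → ℝ) (x : Cn n) :
    HasDerivAt (fun s => wscale w s x) (fun i => (w i : ℂ) * x i) 0 := by
  refine hasDerivAt_pi.mpr fun i => ?_
  have h : HasDerivAt (fun s : ℝ => Real.exp (s * w i)) (w i) 0 := by
    simpa using ((hasDerivAt_id (0 : ℝ)).mul_const (w i)).exp
  exact h.ofReal_comp.mul_const (x i)

theorem wscale_zero (w : Fin n → ℝ) (x : Cn n) : wscale w 0 x = x := by
  ext i; simp [wscale]

theorem fderiv_apply_eq_sum_partialFun (G : Cn n → ℂ) (x v : Cn n) :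
    fderiv ℂ G x v = ∑ i, v i * partialFun i G x := by
  conv_lhs => rw [← Finset.univ_sum_single v, map_sum]
  refine Finset.sum_congr rfl fun i _ => ?_
  rw [partialFun, ← smul_eq_mul, ← map_smul]
  congr 1
  rw [← Pi.single_smul, smul_eq_mul, mul_one]

/-- The Euler field belongs to `Θ_V⁰` when `V` is invariant under the weighted scalings. -/
theorem euler_mem_weightZeroPart (hV : ∀ s, ∀ x ∈ V, wscale w s x ∈ V) :
    (fun i => C (w i : ℂ) * X i) ∈ weightZeroPart w V N := by
  have hX : ∀ i, IsWeightedHomogeneous w (C (w i : ℂ) * X i : MvPolynomial (Fin n) ℂ) (w i) :=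
    fun i => (isWeightedHomogeneous_X ℂ w i).C_mul _
  refine ⟨fun i => polyGerm (C (w i : ℂ) * X i), ⟨?_, fun i => ?_⟩,
    fun i => polyFun (C (w i : ℂ) * X i), fun i => C (w i : ℂ) * X i, fun i => rfl,
    fun i => IsJet.refl N _, fun i => ?_⟩
  · rintro ⟨_, G, hG, rfl⟩ hmem
    change dGerm (germ G hG) _ ∈ _
    rw [mem_vanishingIdeal_iff (coe_dGerm_germ (fun i => rfl) G hG)]
    have h1 := (germ_mem_vanishingIdeal V G hG).mp hmem
    filter_upwards [h1.eventually_nhds, hG.eventually_analyticAt] with x hx hGx hxV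
    have hd : HasFDerivAt G ((fderiv ℂ G x).restrictScalars ℝ) (wscale w 0 x) := by
      rw [wscale_zero]
      exact hGx.differentiableAt.hasFDerivAt.restrictScalars ℝ
    have h2 := hd.comp_hasDerivAt (0 : ℝ) (hasDerivAt_wscale w x)
    have h3 : (G ∘ fun s => wscale w s x) =ᶠ[𝓝 0] fun _ => 0 := by
      have h4 := (hasDerivAt_wscale w x).continuousAt.eventually (p := fun y => y ∈ V → G y = 0)
        (by simpa only [wscale_zero] using hx)
      exact h4.mono fun s hs => hs (hV s x hxV)
    have h5 := (h2.congr_of_eventuallyEq h3.symm).unique (hasDerivAt_const 0 (0 : ℂ))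
    rw [ContinuousLinearMap.coe_restrictScalars', fderiv_apply_eq_sum_partialFun] at h5
    simpa [polyFun] using h5
  · change polyFun _ 0 = 0
    simp [polyFun]
  · exact (hX i).weightedHomogeneousComponent_same.symm

end

/-! ### Pencils of surjective linear maps -/

section Pencil

variable {L W : Type*} [AddCommGroup L] [Module ℂ L] [AddCommGroup W] [Module ℂ W]
  [FiniteDimensional ℂ W]

/-- In a pencil through a surjective map, all but finitely many members are surjective. -/
theorem finite_not_surjective_pencil {T₀ : L →ₗ[ℂ] W} (T₁ : L →ₗ[ℂ] W)
    (h₀ : Function.Surjective T₀) :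
    {t : ℂ | ¬ Function.Surjective ((1 - t) • T₀ + t • T₁)}.Finite := by
  obtain ⟨S, hS⟩ := T₀.exists_rightInverse_of_surjective (LinearMap.range_eq_top.mpr h₀)
  have hfin := Module.End.finite_spectrum (T₁ ∘ₗ S : Module.End ℂ W)
  refine (hfin.preimage (f := fun t : ℂ => 1 - t⁻¹) ?_).subset ?_
  · intro a _ b _ h
    simpa using h
  · intro t ht
    have ht0 : t ≠ 0 := by
      rintro rfl
      exact ht (by simpa using h₀)
    rw [Set.mem_preimage, spectrum.mem_iff]
    intro hu
    apply ht
    have hb := ((Module.End.isUnit_iff _).mp hu).2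
    intro y
    obtain ⟨x, hx⟩ := hb (-t⁻¹ • y)
    refine ⟨S x, ?_⟩
    have h1 : T₀ (S x) = x := LinearMap.congr_fun hS x
    have h2 : T₁ (S x) = (1 - t⁻¹) • x + t⁻¹ • y := by
      have h3 : (1 - t⁻¹) • x - T₁ (S x) = -t⁻¹ • y := hx
      rw [neg_smul] at h3
      rw [← sub_eq_zero] at h3 ⊢
      rw [← neg_eq_zero, ← h3]; abel
    simp only [LinearMap.add_apply, LinearMap.smul_apply, h1, h2, smul_add, smul_smul,
      mul_inv_cancel₀ ht0, one_smul, ← add_assoc, ← add_smul, mul_sub, mul_one]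
    simp

/-- Near a surjective member of a pencil the equation `((1 - t) T₀ + t T₁) x = y` has a solution
that depends continuously on `t` (by Cramer's rule). -/
theorem exists_continuous_solution (T₀ T₁ : L →ₗ[ℂ] W) {t₀ : ℂ}
    (h : Function.Surjective ((1 - t₀) • T₀ + t₀ • T₁)) (y : W) :
    ∃ (m : ℕ) (ζ : Fin m → L) (c : ℂ → Fin m → ℂ), ∀ᶠ t in 𝓝 t₀, ContinuousAt c t ∧
      ((1 - t) • T₀ + t • T₁) (∑ j, c t j • ζ j) = y := by
  obtain ⟨S, hS⟩ := LinearMap.exists_rightInverse_of_surjective _ (LinearMap.range_eq_top.mpr h)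
  let b := Module.finBasis ℂ W
  let A : ℂ → Matrix _ _ ℂ := fun t => (1 - t) • LinearMap.toMatrix b b (T₀ ∘ₗ S) +
    t • LinearMap.toMatrix b b (T₁ ∘ₗ S)
  have hA : ∀ t, A t = LinearMap.toMatrix b b (((1 - t) • T₀ + t • T₁) ∘ₗ S) := fun t => by
    rw [LinearMap.add_comp, LinearMap.smul_comp, LinearMap.smul_comp, map_add, map_smul, map_smul]
  have hAc : Continuous A := by fun_prop
  have hdet : Continuous fun t => (A t).det := hAc.matrix_det
  have h0 : (A t₀).det ≠ 0 := by
    rw [hA, hS, LinearMap.toMatrix_id, Matrix.det_one]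
    exact one_ne_zero
  refine ⟨_, fun j => S (b j), fun t => (A t).det⁻¹ • Matrix.cramer (A t) (b.repr y), ?_⟩
  filter_upwards [hdet.continuousAt.eventually_ne h0] with t ht
  refine ⟨(hdet.continuousAt.inv₀ ht).smul
    (hAc.matrix_cramer continuous_const).continuousAt, ?_⟩
  set c := (A t).det⁻¹ • Matrix.cramer (A t) (b.repr y) with hc
  have h1 : (A t).mulVec c = b.repr y := by
    rw [hc, Matrix.mulVec_smul, Matrix.mulVec_cramer, smul_smul, inv_mul_cancel₀ ht, one_smul]
  have h2 : (∑ j, c j • S (b j)) = S (∑ j, c j • b j) := by simp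
  rw [h2]
  apply b.repr.injective
  ext i
  rw [← h1, hA]
  have h3 := LinearMap.toMatrix_mulVec_repr b b (((1 - t) • T₀ + t • T₁) ∘ₗ S) (∑ j, c j • b j)
  have h4 : (b.repr (∑ j, c j • b j) : _ → ℂ) = c := by
    ext i; rw [b.repr_sum_self]
  rw [h4] at h3
  exact (congrFun h3 i).symm

end Pencil

/-! ### Linear differential equations -/

section LinearODE

open Set

variable {E : Type*} [NormedAddCommGroup E] [NormedSpace ℂ E]

/-- A curve with `‖z'‖ ≤ K ‖z‖` that vanishes at one end of `[0, 1]` vanishes identically. -/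
theorem eq_zero_of_norm_deriv_le {z z' : ℝ → E} {K : ℝ}
    (hz : ∀ s ∈ Icc (0 : ℝ) 1, HasDerivWithinAt z (z' s) (Icc 0 1) s)
    (hK : ∀ s ∈ Icc (0 : ℝ) 1, ‖z' s‖ ≤ K * ‖z s‖) (h : z 0 = 0 ∨ z 1 = 0) :
    ∀ s ∈ Icc (0 : ℝ) 1, z s = 0 := by
  have key : ∀ {z z' : ℝ → E}, (∀ s ∈ Icc (0 : ℝ) 1, HasDerivWithinAt z (z' s) (Icc 0 1) s) →
      (∀ s ∈ Icc (0 : ℝ) 1, ‖z' s‖ ≤ K * ‖z s‖) → z 0 = 0 → ∀ s ∈ Icc (0 : ℝ) 1, z s = 0 := by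
    intro z z' hz hK h
    refine eq_zero_of_abs_deriv_le_mul_abs_self_of_eq_zero_right
      (fun s hs => (hz s hs).continuousWithinAt) (fun s hs => ?_) h
      (fun s hs => hK s (Ico_subset_Icc_self hs))
    exact (hz s (Ico_subset_Icc_self hs)).mono_of_mem_nhdsWithin (Icc_mem_nhdsGE_of_mem hs)
  rcases h with h | h
  · exact key hz hK h
  · -- reverse time
    have hmaps : MapsTo (fun s : ℝ => 1 - s) (Icc 0 1) (Icc 0 1) := fun s hs =>
      ⟨by linarith [hs.2], by linarith [hs.1]⟩
    have h1 := key (z := fun s => z (1 - s)) (z' := fun s => -z' (1 - s)) (fun s hs => ?_)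
      (fun s hs => by rw [norm_neg]; exact hK _ (hmaps hs)) (by simpa using h)
    · intro s hs
      simpa using h1 (1 - s) (hmaps hs)
    · have h2 : HasDerivWithinAt (fun s : ℝ => 1 - s) (-1) (Icc 0 1) s :=
        ((hasDerivAt_id s).const_sub 1).hasDerivWithinAt
      simpa [Function.comp_def] using (hz (1 - s) (hmaps hs)).scomp s h2 hmaps

/-- The fundamental solution of `A' = M A` on `[0, 1]`, for small `M`. -/
theorem exists_fundamental_solution [CompleteSpace E] {M : ℝ → E →L[ℂ] E}
    (hM : ContinuousOn M (Icc 0 1)) (hM' : ∀ s ∈ Icc (0 : ℝ) 1, ‖M s‖ ≤ 1 / 4) :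
    ∃ A : ℝ → E →L[ℂ] E, A 0 = 1 ∧
      ∀ s ∈ Icc (0 : ℝ) 1, HasDerivWithinAt A (M s * A s) (Icc 0 1) s := by
  have hP : IsPicardLindelof (fun s (A : E →L[ℂ] E) => M s * A) (tmin := 0) (tmax := 1)
      ⟨0, by simp⟩ 1 1 0 (1 / 2) 1 := by
    refine ⟨fun s hs => ?_, fun A _ => hM.mul continuousOn_const, fun s hs A hA => ?_, by norm_num⟩
    · refine LipschitzOnWith.of_dist_le_mul fun A _ B _ => ?_
      rw [dist_eq_norm, dist_eq_norm, ← mul_sub]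
      calc ‖M s * (A - B)‖ ≤ ‖M s‖ * ‖A - B‖ := norm_mul_le _ _
        _ ≤ 1 * ‖A - B‖ := by gcongr; linarith [hM' s hs]
    · have h1 : ‖A‖ ≤ 2 := by
        have h2 : ‖A - 1‖ ≤ 1 := by simpa [dist_eq_norm] using hA
        have h3 : ‖(1 : E →L[ℂ] E)‖ ≤ 1 := ContinuousLinearMap.norm_id_le
        calc ‖A‖ = ‖(A - 1) + 1‖ := by rw [sub_add_cancel]
          _ ≤ ‖A - 1‖ + ‖(1 : E →L[ℂ] E)‖ := norm_add_le _ _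
          _ ≤ 2 := by linarith
      calc ‖M s * A‖ ≤ ‖M s‖ * ‖A‖ := norm_mul_le _ _
        _ ≤ 1 / 4 * 2 := mul_le_mul (hM' s hs) h1 (norm_nonneg _) (by norm_num)
        _ = ((1 / 2 : NNReal) : ℝ) := by norm_num
  obtain ⟨A, h0, hA⟩ := hP.exists_eq_forall_mem_Icc_hasDerivWithinAt₀
  exact ⟨A, h0, hA⟩

/-- Along a solution of `z' = M z`, membership in a subspace stable under every `M s` holds at
time `0` if and only if it holds at time `1`. -/
theorem mem_iff_of_linear_ode [FiniteDimensional ℂ E] {M : ℝ → E →L[ℂ] E} {K : ℝ}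
    (hM' : ∀ s ∈ Icc (0 : ℝ) 1, ‖M s‖ ≤ K) {Z : Submodule ℂ E}
    (hZ : ∀ s ∈ Icc (0 : ℝ) 1, ∀ v ∈ Z, M s v ∈ Z) {z : ℝ → E}
    (hz : ∀ s ∈ Icc (0 : ℝ) 1, HasDerivWithinAt z (M s (z s)) (Icc 0 1) s) :
    z 0 ∈ Z ↔ z 1 ∈ Z := by
  -- the component of `z` in a complement of `Z` satisfies a linear equation of its own
  obtain ⟨q, hq, hqq⟩ : ∃ q : E →L[ℂ] E, (∀ v, q v = 0 ↔ v ∈ Z) ∧ ∀ v, q (q v) = q v := by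
    obtain ⟨Z', hZ'⟩ := Z.exists_isCompl
    refine ⟨LinearMap.toContinuousLinearMap (Z'.projection Z hZ'.symm),
      fun v => Z'.projection_apply_eq_zero_iff hZ'.symm,
      fun v => Z'.projection_apply_of_mem_left hZ'.symm (Z'.projection_apply_mem hZ'.symm v)⟩
  have hqM : ∀ s ∈ Icc (0 : ℝ) 1, ∀ v, q (M s v) = q (M s (q v)) := fun s hs v => by
    rw [← sub_eq_zero, ← map_sub, ← map_sub, hq]
    exact hZ s hs _ ((hq _).mp (by rw [map_sub, hqq, sub_self]))
  have hu : ∀ s ∈ Icc (0 : ℝ) 1,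
      HasDerivWithinAt (fun s => q (z s)) (q (M s (z s))) (Icc 0 1) s := fun s hs =>
    (q.restrictScalars ℝ).hasFDerivAt.comp_hasDerivWithinAt s (hz s hs)
  have hb : ∀ s ∈ Icc (0 : ℝ) 1, ‖q (M s (z s))‖ ≤ (‖q‖ * K) * ‖q (z s)‖ := fun s hs => by
    rw [hqM s hs, mul_assoc]
    refine (q.le_opNorm _).trans ?_
    gcongr
    exact (M s).le_of_opNorm_le (hM' s hs) _
  rw [← hq, ← hq]
  exact ⟨fun h => eq_zero_of_norm_deriv_le hu hb (Or.inl h) 1 (by simp),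
    fun h => eq_zero_of_norm_deriv_le hu hb (Or.inr h) 0 (by simp)⟩

end LinearODE

/-! ### Flows of linearizable polynomial vector fields -/

section Flow

open Set

variable {ι : Type*} [Fintype ι]

/-- The map `ℂⁿ → ℂ^ι` whose components are the polynomials `b k`. -/
def polyMap (b : ι → MvPolynomial (Fin n) ℂ) (x : Cn n) : ι → ℂ := fun k => polyFun (b k) x

theorem analyticOnNhd_polyMap (b : ι → MvPolynomial (Fin n) ℂ) :
    AnalyticOnNhd ℂ (polyMap b) univ := fun x _ =>
  analyticAt_pi_iff.mpr fun k => analyticAt_polyFun (b k) x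

theorem hasDerivWithinAt_polyFun_comp (p : MvPolynomial (Fin n) ℂ) {y : ℝ → Cn n} {y' : Cn n}
    {S : Set ℝ} {s : ℝ} (hy : HasDerivWithinAt y y' S s) :
    HasDerivWithinAt (fun s => polyFun p (y s)) (∑ i, polyFun (pderiv i p) (y s) * y' i) S s := by
  have h := ((hasFDerivAt_polyFun p (y s)).restrictScalars ℝ).comp_hasDerivWithinAt s hy
  refine h.congr_deriv ?_
  simp [_root_.sum_apply]

/-- A time-dependent polynomial vector field `ξ` that acts linearly, through `M`, on the span of
finitely many polynomials `b k`, among them the coordinates, has on `[0, 1]` the flow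
`ψ_s(x)ᵢ = (A(s) b(x))_{j(i)}` with `A' = M A`. Indeed `s ↦ A(s) b(x)` and `s ↦ b(ψ_s(x))` satisfy
the same linear equation. -/
theorem exists_linearizable_flow {b : ι → MvPolynomial (Fin n) ℂ} {j : Fin n → ι}
    (hj : ∀ i, b (j i) = X i) {ξ : ℝ → Fin n → MvPolynomial (Fin n) ℂ}
    {M : ℝ → (ι → ℂ) →L[ℂ] (ι → ℂ)} (hM : ContinuousOn M (Icc 0 1))
    (hM' : ∀ s ∈ Icc (0 : ℝ) 1, ‖M s‖ ≤ 1 / 4)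
    (hξ : ∀ s ∈ Icc (0 : ℝ) 1, ∀ x k, polyFun (lieDeriv (ξ s) (b k)) x = M s (polyMap b x) k) :
    ∃ A : ℝ → (ι → ℂ) →L[ℂ] (ι → ℂ), A 0 = 1 ∧
      (∀ s ∈ Icc (0 : ℝ) 1, HasDerivWithinAt A (M s * A s) (Icc 0 1) s) ∧
      ∀ x, ∀ s ∈ Icc (0 : ℝ) 1, polyMap b (fun i => A s (polyMap b x) (j i)) =
        A s (polyMap b x) := by
  classical
  obtain ⟨A, hA0, hA⟩ := exists_fundamental_solution hM hM'
  refine ⟨A, hA0, hA, fun x => ?_⟩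
  set z : ℝ → ι → ℂ := fun s => A s (polyMap b x) with hzdef
  have hz : ∀ s ∈ Icc (0 : ℝ) 1, HasDerivWithinAt z (M s (z s)) (Icc 0 1) s := fun s hs =>
    (((ContinuousLinearMap.apply ℂ (ι → ℂ) (polyMap b x)).restrictScalars
      ℝ).hasFDerivAt.comp_hasDerivWithinAt s (hA s hs))
  set ψ : ℝ → Cn n := fun s i => z s (j i) with hψdef
  have hψ : ∀ s ∈ Icc (0 : ℝ) 1,
      HasDerivWithinAt ψ (fun i => M s (z s) (j i)) (Icc 0 1) s := fun s hs =>
    hasDerivWithinAt_pi.mpr fun i => hasDerivWithinAt_pi.mp (hz s hs) (j i)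
  -- `Q s u` is `u` minus the derivative of the map `b` at `ψ s`, applied to the coordinates of `u`
  let Q : ℝ → (ι → ℂ) → ι → ℂ := fun s u k =>
    u k - ∑ i, polyFun (pderiv i (b k)) (ψ s) * u (j i)
  have hD : ∀ s ∈ Icc (0 : ℝ) 1, HasDerivWithinAt (fun s => z s - polyMap b (ψ s))
      (Q s (M s (z s - polyMap b (ψ s)))) (Icc 0 1) s := fun s hs => by
    have h1 : HasDerivWithinAt (fun s => z s - polyMap b (ψ s)) (Q s (M s (z s))) (Icc 0 1) s :=
      hasDerivWithinAt_pi.mpr fun k => (hasDerivWithinAt_pi.mp (hz s hs) k).sub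
        (hasDerivWithinAt_polyFun_comp (b k) (hψ s hs))
    have h2 : Q s (M s (polyMap b (ψ s))) = 0 := by
      ext k
      have h3 : ∀ i, M s (polyMap b (ψ s)) (j i) = polyFun (ξ s i) (ψ s) := fun i => by
        rw [← hξ s hs, hj, lieDeriv_X]
      simp only [Q, h3, Pi.zero_apply]
      rw [← hξ s hs, polyFun_lieDeriv, sub_eq_zero]
      exact Finset.sum_congr rfl fun i _ => mul_comm _ _
    have h4 : ∀ u v, Q s (u - v) = Q s u - Q s v := fun u v => by
      ext k
      simp only [Q, Pi.sub_apply, mul_sub, Finset.sum_sub_distrib]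
      ring
    rwa [map_sub, h4, h2, sub_zero]
  obtain ⟨C, hC⟩ : ∃ C : ℝ, ∀ s ∈ Icc (0 : ℝ) 1, ∀ i k, ‖polyFun (pderiv i (b k)) (ψ s)‖ ≤ C := by
    have hc : ContinuousOn (fun s (i : Fin n) (k : ι) => polyFun (pderiv i (b k)) (ψ s))
        (Icc 0 1) :=
      continuousOn_pi.mpr fun i => continuousOn_pi.mpr fun k =>
        (continuous_iff_continuousAt.mpr fun x =>
          (analyticAt_polyFun (pderiv i (b k)) x).continuousAt).comp_continuousOn
          fun s hs => (hψ s hs).continuousWithinAt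
    obtain ⟨C, hC⟩ := isCompact_Icc.exists_bound_of_continuousOn hc
    exact ⟨C, fun s hs i k => ((norm_le_pi_norm (fun k => polyFun (pderiv i (b k)) (ψ s)) k).trans
      (norm_le_pi_norm (fun i k => polyFun (pderiv i (b k)) (ψ s)) i)).trans (hC s hs)⟩
  have hQ : ∀ s ∈ Icc (0 : ℝ) 1, ∀ u, ‖Q s u‖ ≤ (1 + n * |C|) * ‖u‖ := fun s hs u => by
    refine (pi_norm_le_iff_of_nonneg (by positivity)).mpr fun k => ?_
    calc ‖Q s u k‖ ≤ ‖u k‖ + ‖∑ i, polyFun (pderiv i (b k)) (ψ s) * u (j i)‖ := norm_sub_le _ _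
      _ ≤ ‖u‖ + ∑ _i : Fin n, |C| * ‖u‖ := by
        refine add_le_add (norm_le_pi_norm u k) ((norm_sum_le _ _).trans
          (Finset.sum_le_sum fun i _ => ?_))
        rw [norm_mul]
        exact mul_le_mul ((hC s hs i k).trans (le_abs_self C)) (norm_le_pi_norm u _)
          (norm_nonneg _) (abs_nonneg C)
      _ = _ := by simp; ring
  have h0 : z 0 - polyMap b (ψ 0) = 0 := by
    have h5 : z 0 = polyMap b x := by simp [hzdef, hA0]
    have h6 : ψ 0 = x := by ext i; simp [hψdef, h5, polyMap, hj, polyFun]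
    rw [h5, h6, sub_self]
  intro s hs
  have h7 := eq_zero_of_norm_deriv_le (K := (1 + n * |C|) * (1 / 4)) hD (fun s hs => by
    refine (hQ s hs _).trans ?_
    rw [mul_assoc]
    gcongr
    exact (M s).le_of_opNorm_le (hM' s hs) _) (Or.inl h0) s hs
  exact (sub_eq_zero.mp h7).symm

end Flow

/-! ### The equivalence relation -/

theorem RVEquiv.refl (V : Set (Cn n)) (h : Cn n → ℂ) : RVEquiv V h h :=
  ⟨OpenPartialHomeomorph.refl _, ⟨trivial, rfl, fun _ _ => analyticAt_id, fun _ _ => analyticAt_id,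
    by simp⟩, EventuallyEq.rfl⟩

theorem image_inter_source_eq_iff {V : Set (Cn n)} {e : OpenPartialHomeomorph (Cn n) (Cn n)} :
    e '' (V ∩ e.source) = V ∩ e.target ↔ ∀ x ∈ e.source, (e x ∈ V ↔ x ∈ V) := by
  constructor
  · intro h x hx
    constructor
    · intro hV
      obtain ⟨y, hy, hxy⟩ : e x ∈ e '' (V ∩ e.source) := h ▸ ⟨hV, e.map_source hx⟩
      exact e.injOn hy.2 hx hxy ▸ hy.1
    · intro hV
      have h2 : e x ∈ V ∩ e.target := h ▸ ⟨x, ⟨hV, hx⟩, rfl⟩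
      exact h2.1
  · intro h
    ext y
    constructor
    · rintro ⟨x, ⟨hxV, hx⟩, rfl⟩
      exact ⟨(h x hx).mpr hxV, e.map_source hx⟩
    · rintro ⟨hyV, hy⟩
      have hx := e.map_target hy
      exact ⟨_, ⟨by rwa [← h _ hx, e.right_inv hy], hx⟩, e.right_inv hy⟩

theorem IsRV.symm {V : Set (Cn n)} {e : OpenPartialHomeomorph (Cn n) (Cn n)} (he : IsRV V e) :
    IsRV V e.symm where
  zero_mem := by simpa [he.map_zero] using e.map_source he.zero_mem
  map_zero := by simpa [he.map_zero] using e.left_inv he.zero_mem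
  analytic := he.analytic_symm
  analytic_symm := he.analytic
  image_eq := image_inter_source_eq_iff.mpr fun y hy => by
    rw [← image_inter_source_eq_iff.mp he.image_eq _ (e.map_target hy), e.right_inv hy]

theorem RVEquiv.symm {V : Set (Cn n)} {h₁ h₂ : Cn n → ℂ} (h : RVEquiv V h₁ h₂) :
    RVEquiv V h₂ h₁ := by
  obtain ⟨e, he, heq⟩ := h
  refine ⟨e.symm, he.symm, ?_⟩
  have h0 : e.symm 0 = 0 := he.symm.map_zero
  have hc : Tendsto e.symm (𝓝 0) (𝓝 0) := by
    simpa [h0] using (e.symm.continuousAt he.symm.zero_mem).tendsto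
  filter_upwards [hc.eventually heq, e.symm.open_source.mem_nhds he.symm.zero_mem] with x hx hxt
  rw [Function.comp_apply, ← hx, Function.comp_apply, e.right_inv hxt]

theorem IsRV.trans {V : Set (Cn n)} {e e' : OpenPartialHomeomorph (Cn n) (Cn n)} (he : IsRV V e)
    (he' : IsRV V e') : IsRV V (e.trans e') where
  zero_mem := by
    rw [e.trans_source]
    exact ⟨he.zero_mem, by simpa [he.map_zero] using he'.zero_mem⟩
  map_zero := by simp [he.map_zero, he'.map_zero]
  analytic := fun x hx => by
    rw [e.trans_source] at hx
    exact (he'.analytic _ hx.2).comp (he.analytic _ hx.1)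
  analytic_symm := fun x hx => by
    rw [e.trans_target] at hx
    exact (he.analytic_symm _ hx.2).comp (he'.analytic_symm _ hx.1)
  image_eq := image_inter_source_eq_iff.mpr fun x hx => by
    rw [e.trans_source] at hx
    exact (image_inter_source_eq_iff.mp he'.image_eq _ hx.2).trans
      (image_inter_source_eq_iff.mp he.image_eq _ hx.1)

theorem RVEquiv.trans {V : Set (Cn n)} {h₁ h₂ h₃ : Cn n → ℂ} (h : RVEquiv V h₁ h₂)
    (h' : RVEquiv V h₂ h₃) : RVEquiv V h₁ h₃ := by
  obtain ⟨e, he, heq⟩ := h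
  obtain ⟨e', he', heq'⟩ := h'
  refine ⟨e'.trans e, he'.trans he, ?_⟩
  have hc : Tendsto e' (𝓝 0) (𝓝 0) := by
    simpa [he'.map_zero] using (e'.continuousAt he'.zero_mem).tendsto
  filter_upwards [hc.eventually heq, heq'] with x hx hx'
  exact hx.trans hx'

/-- An analytic map with an analytic left inverse that fixes `0` and respects `V` represents an
element of `𝓡_V`. -/
theorem rvEquiv_of_leftInverse {V : Set (Cn n)} {ψ χ : Cn n → Cn n}
    (hψ : AnalyticOnNhd ℂ ψ Set.univ) (hχ : AnalyticOnNhd ℂ χ Set.univ)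
    (hχψ : ∀ x, χ (ψ x) = x) (h0 : ψ 0 = 0) (hV : ∀ x, ψ x ∈ V ↔ x ∈ V) {h₁ h₂ : Cn n → ℂ}
    (h : ∀ x, h₁ (ψ x) = h₂ x) : RVEquiv V h₁ h₂ := by
  have hd := (hψ 0 trivial).hasStrictFDerivAt
  have hinj : Function.Injective (fderiv ℂ ψ 0) := by
    have h1 : (fderiv ℂ χ (ψ 0)).comp (fderiv ℂ ψ 0) = ContinuousLinearMap.id ℂ (Cn n) := by
      rw [← fderiv_comp _ (hχ _ trivial).differentiableAt (hψ 0 trivial).differentiableAt,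
        show χ ∘ ψ = id from funext hχψ, fderiv_id]
    intro u v huv
    rw [← ContinuousLinearMap.id_apply (R₁ := ℂ) u, ← ContinuousLinearMap.id_apply (R₁ := ℂ) v,
      ← h1, ContinuousLinearMap.comp_apply, ContinuousLinearMap.comp_apply, huv]
  let D : Cn n ≃L[ℂ] Cn n := (LinearEquiv.ofInjectiveEndo
    (fderiv ℂ ψ 0 : Cn n →ₗ[ℂ] Cn n) hinj).toContinuousLinearEquiv
  have hD : (D : Cn n →L[ℂ] Cn n) = fderiv ℂ ψ 0 := by ext; rfl
  have hd' : HasStrictFDerivAt ψ (D : Cn n →L[ℂ] Cn n) 0 := by rwa [hD]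
  let e := hd'.toOpenPartialHomeomorph ψ
  have hsymm : ∀ y ∈ e.target, e.symm y = χ y := fun y hy => by
    conv_rhs => rw [← e.right_inv hy]
    exact (hχψ _).symm
  refine ⟨e, ⟨hd'.mem_toOpenPartialHomeomorph_source, h0, fun x _ => hψ x trivial,
    fun y hy => ?_, image_inter_source_eq_iff.mpr fun x _ => hV x⟩, Eventually.of_forall h⟩
  exact (hχ y trivial).congr (by
    filter_upwards [e.open_target.mem_nhds hy] with z hz using (hsymm z hz).symm)

/-! ### Trivialization of a family along a linearizable vector field -/

/-- If `∂/∂s + ξ_s` annihilates the family `H₀ + s H₁` for `s ∈ [0, 1]` and `ξ` acts linearly on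
the span of the polynomials `b k`, preserving the subspace `Z` that cuts out `V`, then the flow of
`ξ` makes the two ends of the family `𝓡_V`-equivalent. -/
theorem rvEquiv_of_linearizable {ι : Type*} [Fintype ι] {V : Set (Cn n)}
    {b : ι → MvPolynomial (Fin n) ℂ} {j : Fin n → ι} (hj : ∀ i, b (j i) = X i)
    (hb0 : polyMap b 0 = 0) {Z : Submodule ℂ (ι → ℂ)} (hZ : ∀ x, polyMap b x ∈ Z ↔ x ∈ V)
    {ξ : ℝ → Fin n → MvPolynomial (Fin n) ℂ} {M : ℝ → (ι → ℂ) →L[ℂ] (ι → ℂ)}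
    (hM : ContinuousOn M (Set.Icc 0 1)) (hM' : ∀ s ∈ Set.Icc (0 : ℝ) 1, ‖M s‖ ≤ 1 / 4)
    (hMZ : ∀ s ∈ Set.Icc (0 : ℝ) 1, ∀ z ∈ Z, M s z ∈ Z)
    (hξ : ∀ s ∈ Set.Icc (0 : ℝ) 1, ∀ x k,
      polyFun (lieDeriv (ξ s) (b k)) x = M s (polyMap b x) k)
    {H₀ H₁ : MvPolynomial (Fin n) ℂ}
    (hH : ∀ s ∈ Set.Icc (0 : ℝ) 1, ∀ x,
      polyFun (lieDeriv (ξ s) (H₀ + (s : ℂ) • H₁)) x = -polyFun H₁ x) :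
    RVEquiv V (polyFun (H₀ + H₁)) (polyFun H₀) := by
  classical
  obtain ⟨A, hA0, hA, hlaw⟩ := exists_linearizable_flow hj hM hM' hξ
  have hz : ∀ u, ∀ s ∈ Set.Icc (0 : ℝ) 1,
      HasDerivWithinAt (fun s => A s u) (M s (A s u)) (Set.Icc 0 1) s := fun u s hs =>
    (((ContinuousLinearMap.apply ℂ (ι → ℂ) u).restrictScalars
      ℝ).hasFDerivAt.comp_hasDerivWithinAt s (hA s hs))
  have h1mem : (1 : ℝ) ∈ Set.Icc (0 : ℝ) 1 := by simp
  -- `A 1` is injective by uniqueness backwards in time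
  have hinj : Function.Injective (A 1 : (ι → ℂ) →ₗ[ℂ] (ι → ℂ)) := by
    rw [← LinearMap.ker_eq_bot, LinearMap.ker_eq_bot']
    intro u hu
    have h := eq_zero_of_norm_deriv_le (hz u)
      (fun s hs => (M s).le_of_opNorm_le (hM' s hs) (A s u)) (Or.inr hu) 0 (by simp)
    simpa [hA0] using h
  obtain ⟨B, hB⟩ := LinearMap.exists_leftInverse_of_injective _ (LinearMap.ker_eq_bot.mpr hinj)
  have han : ∀ T : (ι → ℂ) →L[ℂ] (ι → ℂ),
      AnalyticOnNhd ℂ (fun (x : Cn n) i => T (polyMap b x) (j i)) Set.univ := fun T x _ =>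
    analyticAt_pi_iff.mpr fun i =>
      (((ContinuousLinearMap.proj (j i) : (ι → ℂ) →L[ℂ] ℂ).comp T).analyticAt _).comp
        (analyticOnNhd_polyMap b x trivial)
  refine rvEquiv_of_leftInverse (ψ := fun x i => A 1 (polyMap b x) (j i))
    (χ := fun x i => LinearMap.toContinuousLinearMap B (polyMap b x) (j i)) (han _) (han _)
    (fun x => ?_) ?_ (fun x => ?_) (fun x => ?_)
  · ext i
    have h : B (A 1 (polyMap b x)) = polyMap b x := LinearMap.congr_fun hB _
    rw [hlaw x 1 h1mem, LinearMap.coe_toContinuousLinearMap', h]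
    simp [polyMap, hj, polyFun]
  · ext i; simp [hb0]
  · rw [← hZ, ← hZ, hlaw x 1 h1mem]
    have h := mem_iff_of_linear_ode hM' hMZ (hz (polyMap b x))
    simpa [hA0] using h.symm
  · -- the family is constant along the flow
    set ψ : ℝ → Cn n := fun s i => A s (polyMap b x) (j i) with hψdef
    have hψ : ∀ s ∈ Set.Icc (0 : ℝ) 1,
        HasDerivWithinAt ψ (fun i => polyFun (ξ s i) (ψ s)) (Set.Icc 0 1) s := fun s hs => by
      refine (hasDerivWithinAt_pi.mpr fun i =>
        hasDerivWithinAt_pi.mp (hz (polyMap b x) s hs) (j i)).congr_deriv ?_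
      ext i
      rw [← hlaw x s hs, ← hξ s hs, hj, lieDeriv_X]
    have hder : ∀ s ∈ Set.Icc (0 : ℝ) 1, HasDerivWithinAt
        (fun s : ℝ => polyFun H₀ (ψ s) + (s : ℂ) * polyFun H₁ (ψ s) - polyFun H₀ x) 0
        (Set.Icc 0 1) s := fun s hs => by
      have h1 := ((hasDerivWithinAt_polyFun_comp H₀ (hψ s hs)).add
        ((hasDerivAt_id s).ofReal_comp.hasDerivWithinAt.mul
          (hasDerivWithinAt_polyFun_comp H₁ (hψ s hs)))).sub_const (polyFun H₀ x)
      refine h1.congr_deriv ?_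
      have h2 := hH s hs (ψ s)
      have h3 : ∀ P, polyFun (lieDeriv (ξ s) P) (ψ s) =
          ∑ i, polyFun (pderiv i P) (ψ s) * polyFun (ξ s i) (ψ s) := fun P => by
        rw [polyFun_lieDeriv]
        exact Finset.sum_congr rfl fun i _ => mul_comm _ _
      rw [← h3, ← h3]
      have h4 : polyFun (lieDeriv (ξ s) (H₀ + (s : ℂ) • H₁)) (ψ s) =
          polyFun (lieDeriv (ξ s) H₀) (ψ s) + s * polyFun (lieDeriv (ξ s) H₁) (ψ s) := by
        rw [map_add, map_smul]
        simp only [polyFun, map_add, smul_eval]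
      rw [h4] at h2
      simp only [id, Complex.ofReal_one, one_mul]
      linear_combination h2
    have hψ0 : ψ 0 = x := by ext i; simp [hψdef, hA0, polyMap, hj, polyFun]
    have h5 := eq_zero_of_norm_deriv_le (K := 0) hder (fun s _ => by simp)
      (Or.inl (by simp [hψ0])) 1 h1mem
    change polyFun (H₀ + H₁) (ψ 1) = polyFun H₀ x
    rw [← sub_eq_zero, ← h5]
    simp [polyFun]

/-! ### Polynomials of bounded weighted degree -/

section Bounded

variable {w : Fin n → ℝ}

theorem finite_weight_le (hw : ∀ i, 0 < w i) (D : ℝ) :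
    {k : Fin n →₀ ℕ | k ≠ 0 ∧ Finsupp.weight w k ≤ D}.Finite := by
  refine (Set.finite_Iic (Finsupp.equivFunOnFinite.symm fun i => ⌊D / w i⌋₊)).subset ?_
  rintro k ⟨-, hk⟩ i
  rw [Finsupp.equivFunOnFinite_symm_apply_apply]
  refine Nat.le_floor ((le_div_iff₀ (hw i)).mpr (le_trans ?_ hk))
  rw [Finsupp.weight_eq_sum]
  simp only [nsmul_eq_mul]
  exact Finset.single_le_sum (f := fun i => (k i : ℝ) * w i)
    (fun i _ => mul_nonneg (Nat.cast_nonneg _) (hw i).le) (Finset.mem_univ i)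

/-- The exponents of the nonconstant monomials of weighted degree at most `D`. The constant monomial
is left out so that the monomial map sends `0` to `0`. -/
def expSet (hw : ∀ i, 0 < w i) (D : ℝ) : Finset (Fin n →₀ ℕ) := (finite_weight_le hw D).toFinset

theorem mem_expSet {hw : ∀ i, 0 < w i} {D : ℝ} {k : Fin n →₀ ℕ} :
    k ∈ expSet hw D ↔ k ≠ 0 ∧ Finsupp.weight w k ≤ D := by
  simp [expSet]

/-- The nonconstant monomials of weighted degree at most `D`. -/
def mon (hw : ∀ i, 0 < w i) (D : ℝ) (k : expSet hw D) : MvPolynomial (Fin n) ℂ :=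
  monomial k.1 1

/-- The coefficients of a polynomial at the nonconstant monomials of weighted degree at most
`D`. -/
def monCoeffs (hw : ∀ i, 0 < w i) (D : ℝ) : MvPolynomial (Fin n) ℂ →ₗ[ℂ] (expSet hw D → ℂ) :=
  LinearMap.pi fun k => lcoeff ℂ k.1

/-- A quasihomogeneous polynomial has no constant term, so the nonconstant monomials suffice. -/
theorem IsQuasihomogeneous.eq_sum_mon (hw : ∀ i, 0 < w i) {D δ : ℝ}
    {P : MvPolynomial (Fin n) ℂ} (hP : IsQuasihomogeneous w δ P) (hδ : δ ≤ D) :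
    P = ∑ k, monCoeffs hw D P k • mon hw D k := by
  have h1 : P.support ⊆ expSet hw D := fun k hk => by
    rw [mem_expSet]
    refine ⟨?_, (hP.1 (mem_support_iff.mp hk)).trans_le hδ⟩
    rintro rfl
    exact mem_support_iff.mp hk hP.2
  conv_lhs => rw [P.as_sum]
  rw [Finset.sum_subset h1 (fun k _ hk => by rw [notMem_support_iff.mp hk, monomial_zero]),
    ← Finset.sum_coe_sort]
  refine Finset.sum_congr rfl fun k _ => ?_
  rw [mon, smul_monomial, smul_eq_mul, mul_one]; rfl

theorem IsQuasihomogeneous.polyFun_eq (hw : ∀ i, 0 < w i) {D δ : ℝ}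
    {P : MvPolynomial (Fin n) ℂ} (hP : IsQuasihomogeneous w δ P) (hδ : δ ≤ D) (x : Cn n) :
    polyFun P x = ∑ k, monCoeffs hw D P k * polyMap (mon hw D) x k := by
  conv_lhs => rw [hP.eq_sum_mon hw hδ]
  simp [polyFun, polyMap]

theorem isQuasihomogeneous_mon (hw : ∀ i, 0 < w i) (D : ℝ) (k : expSet hw D) :
    IsQuasihomogeneous w (Finsupp.weight w k.1) (mon hw D k) := by
  classical
  refine ⟨isWeightedHomogeneous_monomial w _ _ rfl, ?_⟩
  rw [mon, constantCoeff_monomial, if_neg (mem_expSet.mp k.2).1]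

theorem isQuasihomogeneous_lieDeriv (hw : ∀ i, 0 < w i) {ξ : Fin n → MvPolynomial (Fin n) ℂ}
    (hξ : ∀ i, IsWeightedHomogeneous w (ξ i) (w i)) {δ : ℝ} {P : MvPolynomial (Fin n) ℂ}
    (hP : IsWeightedHomogeneous w P δ) : IsQuasihomogeneous w δ (lieDeriv ξ P) := by
  refine ⟨isWeightedHomogeneous_lieDeriv hξ hP, ?_⟩
  rw [lieDeriv_apply, map_sum]
  refine Finset.sum_eq_zero fun i _ => ?_
  rw [map_mul, constantCoeff_eq, (hξ i).coeff_eq_zero 0 (by simpa using (hw i).ne), zero_mul]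

/-- The action of a vector field on `ℂ^ι` that corresponds, under the monomial map
`ℂⁿ → ℂ^ι`, to its action on the monomials of weighted degree at most `D`. -/
def linearAction (hw : ∀ i, 0 < w i) (D : ℝ) : (Fin n → MvPolynomial (Fin n) ℂ) →ₗ[ℂ]
    (expSet hw D → ℂ) →L[ℂ] (expSet hw D → ℂ) where
  toFun ξ := LinearMap.toContinuousLinearMap
    (Matrix.toLin' (Matrix.of fun k => monCoeffs hw D (lieDeriv ξ (mon hw D k))))
  map_add' ξ ζ := by
    ext z k
    simp [Matrix.mulVec, dotProduct, add_mul, Finset.sum_add_distrib]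
  map_smul' c ξ := by
    ext z k
    simp [Matrix.mulVec, dotProduct, mul_assoc, Finset.mul_sum]

theorem linearAction_apply (hw : ∀ i, 0 < w i) (D : ℝ) (ξ : Fin n → MvPolynomial (Fin n) ℂ)
    (z : expSet hw D → ℂ) (k : expSet hw D) :
    linearAction hw D ξ z k = ∑ l, monCoeffs hw D (lieDeriv ξ (mon hw D k)) l * z l := rfl

theorem linearAction_polyMap (hw : ∀ i, 0 < w i) (D : ℝ) {ξ : Fin n → MvPolynomial (Fin n) ℂ}
    (hξ : ∀ i, IsWeightedHomogeneous w (ξ i) (w i)) (x : Cn n) (k : expSet hw D) :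
    polyFun (lieDeriv ξ (mon hw D k)) x = linearAction hw D ξ (polyMap (mon hw D) x) k :=
  (isQuasihomogeneous_lieDeriv hw hξ (isQuasihomogeneous_mon hw D k).1).polyFun_eq hw
    (mem_expSet.mp k.2).2 x

/-- `linearAction ξ` is transposed to the action of `ξ` on coefficient vectors. -/
theorem sum_monCoeffs_mul_linearAction (hw : ∀ i, 0 < w i) {D δ : ℝ} (hδ : δ ≤ D)
    (ξ : Fin n → MvPolynomial (Fin n) ℂ)
    {P : MvPolynomial (Fin n) ℂ} (hP : IsQuasihomogeneous w δ P) (z : expSet hw D → ℂ) :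
    ∑ k, monCoeffs hw D P k * linearAction hw D ξ z k =
      ∑ l, monCoeffs hw D (lieDeriv ξ P) l * z l := by
  have h : monCoeffs hw D (lieDeriv ξ P) =
      ∑ k, monCoeffs hw D P k • monCoeffs hw D (lieDeriv ξ (mon hw D k)) := by
    conv_lhs => rw [hP.eq_sum_mon hw hδ, map_sum, map_sum]
    simp only [map_smul]
  simp only [h, linearAction_apply, Finset.sum_apply, Pi.smul_apply, smul_eq_mul, Finset.sum_mul,
    Finset.mul_sum]
  rw [Finset.sum_comm]
  simp only [mul_assoc]

/-- The vectors annihilated by all quasihomogeneous polynomials of degree `r` that vanish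
on `V`. -/
def cutOut (hw : ∀ i, 0 < w i) (D r : ℝ) (V : Set (Cn n)) : Submodule ℂ (expSet hw D → ℂ) where
  carrier := {z | ∀ P, IsQuasihomogeneous w r P → (∀ x ∈ V, polyFun P x = 0) →
    ∑ k, monCoeffs hw D P k * z k = 0}
  add_mem' h1 h2 P hP hPV := by
    simp only [Pi.add_apply, mul_add, Finset.sum_add_distrib, h1 P hP hPV, h2 P hP hPV, add_zero]
  zero_mem' P _ _ := by simp
  smul_mem' c z h P hP hPV := by
    simp only [Pi.smul_apply, smul_eq_mul, mul_left_comm _ c, ← Finset.mul_sum, h P hP hPV,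
      mul_zero]

theorem polyMap_mem_cutOut_iff (hw : ∀ i, 0 < w i) {D r : ℝ} (hr : r ≤ D)
    {Φ : MvPolynomial (Fin n) ℂ} (hΦ : IsQuasihomogeneous w r Φ) (x : Cn n) :
    polyMap (mon hw D) x ∈ cutOut hw D r (zeroSet Φ) ↔ x ∈ zeroSet Φ := by
  constructor
  · intro h
    have := h Φ hΦ fun _ hx => hx
    rwa [← hΦ.polyFun_eq hw hr] at this
  · intro hx P hP hPV
    rw [← hP.polyFun_eq hw hr, hPV x hx]

end Bounded

/-! ### Local triviality of the pencil and conclusion -/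

section Pencil

variable {w : Fin n → ℝ}

theorem mem_zeroSet_wscale {r : ℝ} {Φ : MvPolynomial (Fin n) ℂ}
    (hΦ : IsQuasihomogeneous w r Φ) (s : ℝ) (x : Cn n) (hx : x ∈ zeroSet Φ) :
    wscale w s x ∈ zeroSet Φ := by
  have h : polyFun Φ x = 0 := hx
  change polyFun Φ _ = 0
  rw [polyFun_wscale hΦ.1, h, mul_zero]

theorem linearAction_mem_cutOut (hw : ∀ i, 0 < w i) {m : ℝ} (hm : ∀ i, m ≤ w i) {N : ℕ} {D r : ℝ}
    (hr : r ≤ D) (hrN : r < N * m) {Φ : MvPolynomial (Fin n) ℂ} (hΦ : IsQuasihomogeneous w r Φ)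
    {ξ : Fin n → MvPolynomial (Fin n) ℂ} (hξ : ξ ∈ weightZeroPart w (zeroSet Φ) N)
    {z : expSet hw D → ℂ} (hz : z ∈ cutOut hw D r (zeroSet Φ)) :
    linearAction hw D ξ z ∈ cutOut hw D r (zeroSet Φ) := fun P hP hPV => by
  rw [sum_monCoeffs_mul_linearAction hw hr ξ hP]
  exact hz _
    (isQuasihomogeneous_lieDeriv hw (isWeightedHomogeneous_of_mem_weightZeroPart hξ) hP.1)
    (polyFun_lieDeriv_eq_zero hw hm (mem_zeroSet_wscale hΦ) hξ hrN hP.1 hPV)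

/-- If near `t₀` the derivative `g - f` of the pencil `(1 - t) f + t g` is `η_t` applied to the
pencil, with weight-zero fields `η_t` depending continuously on `t`, then the members of the pencil
near `t₀` are `𝓡_V`-equivalent to the one at `t₀`. -/
theorem eventually_rvEquiv (hw : ∀ i, 0 < w i) {m : ℝ} (hm : ∀ i, m ≤ w i) {N : ℕ} {D r : ℝ}
    (hD : ∀ i, w i ≤ D) (hr : r ≤ D) (hrN : r < N * m) {f g Φ : MvPolynomial (Fin n) ℂ}
    (hΦ : IsQuasihomogeneous w r Φ) {t₀ : ℂ} {k : ℕ}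
    {ζ : Fin k → weightZeroPart w (zeroSet Φ) N} {c : ℂ → Fin k → ℂ}
    (hc : ∀ᶠ t in 𝓝 t₀, ContinuousAt c t ∧
      lieDeriv (∑ j, c t j • ζ j : weightZeroPart w (zeroSet Φ) N).1 ((1 - t) • f + t • g) =
        g - f) :
    ∀ᶠ t in 𝓝 t₀, RVEquiv (zeroSet Φ) (polyFun ((1 - t) • f + t • g))
      (polyFun ((1 - t₀) • f + t₀ • g)) := by
  classical
  obtain ⟨act, hact'⟩ : ∃ act : weightZeroPart w (zeroSet Φ) N →ₗ[ℂ]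
      (expSet hw D → ℂ) →L[ℂ] (expSet hw D → ℂ), ∀ ξ, act ξ = linearAction hw D ξ.1 :=
    ⟨linearAction hw D ∘ₗ Submodule.subtype _, fun _ => rfl⟩
  let η : ℂ → weightZeroPart w (zeroSet Φ) N := fun t => ∑ j, c t j • ζ j
  have hact : ∀ t, ContinuousAt c t → ContinuousAt (fun t => act (η t)) t := fun t ht => by
    have h1 : (fun t => act (η t)) = fun t => ∑ j, c t j • act (ζ j) := by
      ext1 t; simp [η]
    rw [h1]
    exact tendsto_finsetSum _ fun j _ => ((continuousAt_pi.mp ht j).smul continuousAt_const)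
  -- for `‖t - t₀‖ ≤ 1 / (4 K)` the linear equation on the segment from `t₀` to `t` is small enough
  -- for `exists_linearizable_flow`
  set K := ‖act (η t₀)‖ + 1 with hK
  have hKpos : 0 < K := by positivity
  have hb : ∀ᶠ t in 𝓝 t₀, ‖act (η t)‖ < K :=
    (hact t₀ hc.self_of_nhds.1).norm.eventually_lt_const (by linarith)
  obtain ⟨ε, hε, hball⟩ := Metric.eventually_nhds_iff.mp (hc.and hb)
  refine Metric.eventually_nhds_iff.mpr ⟨min ε (1 / (4 * K)), by positivity, fun t ht => ?_⟩
  rw [dist_eq_norm] at ht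
  set v := t - t₀ with hv
  have hγ : ∀ s ∈ Set.Icc (0 : ℝ) 1, dist (t₀ + s * v) t₀ < ε := fun s hs => by
    rw [dist_eq_norm, add_sub_cancel_left, norm_mul, Complex.norm_real, Real.norm_of_nonneg hs.1]
    calc s * ‖v‖ ≤ 1 * ‖v‖ := by gcongr; exact hs.2
      _ < ε := by rw [one_mul]; exact ht.trans_le (min_le_left _ _)
  have hj : ∀ i : Fin n, Finsupp.single i 1 ∈ expSet hw D := fun i =>
    mem_expSet.mpr ⟨by simp, by simpa [Finsupp.weight_single] using hD i⟩
  have hend : ((1 - t₀) • f + t₀ • g) + v • (g - f) = (1 - t) • f + t • g := by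
    rw [hv]; module
  rw [← hend]
  refine rvEquiv_of_linearizable (b := mon hw D) (j := fun i => ⟨_, hj i⟩) (fun i => rfl) ?_
    (polyMap_mem_cutOut_iff hw hr hΦ)
    (ξ := fun s => (-v • η (t₀ + s * v) : weightZeroPart w (zeroSet Φ) N))
    (M := fun s => act (-v • η (t₀ + s * v))) ?_ ?_ ?_ ?_ ?_
  · ext k
    have h := (isQuasihomogeneous_mon hw D k).2
    change eval 0 _ = 0
    rw [← h, constantCoeff_eq, ← constantCoeff_eq, eval_zero]
  · intro s hs
    have h1 : ContinuousAt (fun s : ℝ => t₀ + s * v) s := by fun_prop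
    have h2 := ContinuousAt.comp (f := fun s : ℝ => t₀ + s * v)
      (hact _ (hball (hγ s hs)).1.1) h1
    simp only [map_smul]
    exact ((continuousAt_const (y := -v)).smul h2).continuousWithinAt
  · intro s hs
    rw [map_smul, norm_smul, norm_neg]
    calc ‖v‖ * ‖act (η (t₀ + s * v))‖ ≤ 1 / (4 * K) * K :=
          mul_le_mul (ht.le.trans (min_le_right _ _)) (hball (hγ s hs)).2.le (norm_nonneg _)
            (by positivity)
      _ = 1 / 4 := by field_simp
  · intro s hs z hz
    rw [hact']
    exact linearAction_mem_cutOut hw hm hr hrN hΦ (Subtype.prop _) hz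
  · intro s hs x k
    rw [hact']
    exact linearAction_polyMap hw D (isWeightedHomogeneous_of_mem_weightZeroPart (Subtype.prop _)) x k
  · intro s hs x
    have h1 := (hball (hγ s hs)).1.2
    have h2 : ((1 - t₀) • f + t₀ • g) + (s : ℂ) • v • (g - f) =
        (1 - (t₀ + s * v)) • f + (t₀ + s * v) • g := by module
    rw [h2, Submodule.coe_smul, map_smul, LinearMap.smul_apply, h1]
    simp [polyFun, smul_eval]

theorem IsQuasihomogeneous.eq_zero (hw : ∀ i, 0 < w i) {f : MvPolynomial (Fin n) ℂ}
    (hf : IsQuasihomogeneous w 0 f) : f = 0 := by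
  ext k
  by_contra hk
  have h1 : Finsupp.weight w k = 0 := hf.1 hk
  rw [Finsupp.weight_eq_sum, Finset.sum_eq_zero_iff_of_nonneg
    fun i _ => nsmul_nonneg (hw i).le _] at h1
  have h2 : k = 0 := by
    ext i
    have h3 := h1 i (Finset.mem_univ i)
    rw [nsmul_eq_mul] at h3
    simpa [(hw i).ne'] using h3
  exact hk (by rw [h2]; exact hf.2)

theorem monCoeffs_injective (hw : ∀ i, 0 < w i) {D δ : ℝ} (hδ : δ ≤ D)
    {P Q : MvPolynomial (Fin n) ℂ} (hP : IsQuasihomogeneous w δ P) (hQ : IsQuasihomogeneous w δ Q)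
    (h : monCoeffs hw D P = monCoeffs hw D Q) : P = Q := by
  rw [hP.eq_sum_mon hw hδ, hQ.eq_sum_mon hw hδ, h]

theorem IsQuasihomogeneous.pencil {d : ℝ} {f g : MvPolynomial (Fin n) ℂ}
    (hf : IsQuasihomogeneous w d f) (hg : IsQuasihomogeneous w d g) (a b : ℂ) :
    IsQuasihomogeneous w d (a • f + b • g) := by
  refine ⟨?_, by simp [smul_eq_C_mul, hf.2, hg.2]⟩
  rw [smul_eq_C_mul, smul_eq_C_mul]
  exact (hf.1.C_mul a).add (hg.1.C_mul b)

end Pencil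

/-- Quasihomogeneous polynomials of the same degree with equal ideals `J(Θ_V⁰)` are
`𝓡_V`-equivalent. -/
theorem rvEquiv_of_J_eq {w : Fin n → ℝ} (hw : ∀ i, 0 < w i) {d r : ℝ}
    {f g Φ : MvPolynomial (Fin n) ℂ} (hf : IsQuasihomogeneous w d f)
    (hg : IsQuasihomogeneous w d g) (hΦ : IsQuasihomogeneous w r Φ)
    (hJ : J (polyGerm f) (ThetaV0 (zeroSet Φ)) = J (polyGerm g) (ThetaV0 (zeroSet Φ))) :
    RVEquiv (zeroSet Φ) (polyFun f) (polyFun g) := by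
  -- in degree `0` both polynomials vanish
  rcases eq_or_ne d 0 with rfl | hd0
  · rw [hf.eq_zero hw, hg.eq_zero hw]
    exact RVEquiv.refl _ _
  obtain ⟨m, hm0, hm⟩ : ∃ m : ℝ, 0 < m ∧ ∀ i, m ≤ w i := by
    rcases isEmpty_or_nonempty (Fin n) with h | h
    · exact ⟨1, one_pos, fun i => h.elim i⟩
    · obtain ⟨i, hi⟩ := Finite.exists_min w
      exact ⟨w i, hw i, hi⟩
  -- terms of order `N` and higher have weighted degree at least `N m`, beyond both `d` and `r`
  obtain ⟨N, hN⟩ := exists_nat_gt (max d r / m)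
  rw [div_lt_iff₀ hm0] at hN
  have hdN : d < N * m := (le_max_left _ _).trans_lt hN
  have hrN : r < N * m := (le_max_right _ _).trans_lt hN
  obtain ⟨D, hDw, hdD, hrD⟩ : ∃ D : ℝ, (∀ i, w i ≤ D) ∧ d ≤ D ∧ r ≤ D := by
    refine ⟨∑ i, w i + |d| + |r|, fun i => ?_, ?_, ?_⟩
    · have := Finset.single_le_sum (fun i _ => (hw i).le) (Finset.mem_univ i)
      linarith [abs_nonneg d, abs_nonneg r]
    · linarith [le_abs_self d, abs_nonneg r, Finset.sum_nonneg fun i (_ : i ∈ Finset.univ) =>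
        (hw i).le]
    · linarith [le_abs_self r, abs_nonneg d, Finset.sum_nonneg fun i (_ : i ∈ Finset.univ) =>
        (hw i).le]
  set L := weightZeroPart w (zeroSet Φ) N
  -- the actions of the weight-zero fields on `f` and on `g`
  obtain ⟨T, hT⟩ : ∃ T : MvPolynomial (Fin n) ℂ → L →ₗ[ℂ] (expSet hw D → ℂ),
      ∀ P (ξ : L), T P ξ = monCoeffs hw D (lieDeriv ξ.1 P) :=
    ⟨fun P => monCoeffs hw D ∘ₗ lieDeriv.flip P ∘ₗ L.subtype, fun P ξ => by
      rw [LinearMap.comp_apply, LinearMap.comp_apply, LinearMap.flip_apply, L.subtype_apply]⟩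
  have hrange : ∀ {p q}, IsQuasihomogeneous w d p → IsQuasihomogeneous w d q →
      J (polyGerm p) (ThetaV0 (zeroSet Φ)) ≤ J (polyGerm q) (ThetaV0 (zeroSet Φ)) →
      LinearMap.range (T p) ≤ LinearMap.range (T q) := by
    rintro p q hp hq h _ ⟨ξ, rfl⟩
    obtain ⟨ξ', hξ', heq⟩ := exists_lieDeriv_eq hw hm ξ.2 hdN hp.1 hq.1 h
    exact ⟨⟨ξ', hξ'⟩, by rw [hT, hT, heq]⟩
  set W := LinearMap.range (T f)
  have hW : LinearMap.range (T g) = W := le_antisymm (hrange hg hf hJ.ge) (hrange hf hg hJ.le)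
  -- by Euler's identity `p = d⁻¹ e(p)` for the Euler field `e`
  have hself : ∀ p, IsQuasihomogeneous w d p → monCoeffs hw D p ∈ LinearMap.range (T p) := by
    intro p hp
    refine ⟨(d : ℂ)⁻¹ • ⟨_, euler_mem_weightZeroPart (mem_zeroSet_wscale hΦ)⟩, ?_⟩
    rw [map_smul, hT, lieDeriv_euler hp.1, C_mul', map_smul, smul_smul,
      inv_mul_cancel₀ (by exact_mod_cast hd0), one_smul]
  have hy : monCoeffs hw D (g - f) ∈ W := by
    rw [map_sub]
    exact sub_mem (hW ▸ hself g hg) (hself f hf)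
  obtain ⟨T₀, hT₀'⟩ : ∃ T₀ : L →ₗ[ℂ] W, ∀ ξ, (T₀ ξ).1 = T f ξ :=
    ⟨(T f).codRestrict W fun ξ => LinearMap.mem_range_self _ ξ, fun ξ =>
      LinearMap.codRestrict_apply ..⟩
  obtain ⟨T₁, hT₁'⟩ : ∃ T₁ : L →ₗ[ℂ] W, ∀ ξ, (T₁ ξ).1 = T g ξ :=
    ⟨(T g).codRestrict W fun ξ => hW ▸ LinearMap.mem_range_self _ ξ, fun ξ =>
      LinearMap.codRestrict_apply ..⟩
  have hT₀ : Function.Surjective T₀ := by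
    rintro ⟨_, ξ, rfl⟩
    exact ⟨ξ, Subtype.ext (hT₀' ξ)⟩
  have hT₁ : Function.Surjective T₁ := by
    rintro ⟨y, hy⟩
    rw [← hW] at hy
    obtain ⟨ξ, hξ⟩ := hy
    exact ⟨ξ, Subtype.ext ((hT₁' ξ).trans hξ)⟩
  have hpencil : ∀ (t : ℂ) (ξ : L), (((1 - t) • T₀ + t • T₁) ξ).1 =
      monCoeffs hw D (lieDeriv ξ.1 ((1 - t) • f + t • g)) := fun t ξ => by
    rw [LinearMap.add_apply, LinearMap.smul_apply, LinearMap.smul_apply, Submodule.coe_add,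
      Submodule.coe_smul, Submodule.coe_smul, hT₀', hT₁', hT, hT, map_add, map_smul, map_smul,
      map_add, map_smul, map_smul]
  -- the members of the pencil on which `L` still spans `W`
  set U := {t : ℂ | ¬ Function.Surjective ((1 - t) • T₀ + t • T₁)}ᶜ with hU
  have hUc : IsPreconnected U :=
    ((finite_not_surjective_pencil T₁ hT₀).countable.isPathConnected_compl_of_one_lt_rank
      (by simp)).isConnected.isPreconnected
  have h0 : (0 : ℂ) ∈ U := by simpa [hU] using hT₀
  have h1 : (1 : ℂ) ∈ U := by simpa [hU] using hT₁
  have hmain := hUc.induction₂ (fun t₀ t => RVEquiv (zeroSet Φ) (polyFun ((1 - t) • f + t • g))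
    (polyFun ((1 - t₀) • f + t₀ • g))) (fun t₀ ht₀ => ?_)
    (fun _ _ _ _ _ _ h h' => h'.trans h) (fun _ _ _ _ h => h.symm) h1 h0
  · simpa using hmain
  · obtain ⟨k, ζ, c, hc⟩ := exists_continuous_solution T₀ T₁ (not_not.mp ht₀) ⟨_, hy⟩
    refine nhdsWithin_le_nhds (eventually_rvEquiv (ζ := ζ) hw hm hDw hrD hrN hΦ
      (hc.mono fun t ht => ⟨ht.1, ?_⟩))
    have h2 := congrArg Subtype.val ht.2
    rw [hpencil] at h2
    refine monCoeffs_injective hw hdD (isQuasihomogeneous_lieDeriv hw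
      (isWeightedHomogeneous_of_mem_weightZeroPart (Subtype.prop _)) (hf.pencil hg _ _).1) ?_ h2
    simpa [sub_eq_neg_add] using hf.pencil hg (-1) 1

end RelMilnor

end

theorem lemma5p1 (n : ℕ) (w : Fin n → ℝ) (hw : ∀ i, 0 < w i) (d r : ℝ)
    (f g Φ : MvPolynomial (Fin n) ℂ)
    (hf : RelMilnor.IsQuasihomogeneous w d f) (hg : RelMilnor.IsQuasihomogeneous w d g)
    (hΦ : RelMilnor.IsQuasihomogeneous w r Φ)
    (hJ : RelMilnor.J (RelMilnor.polyGerm f) (RelMilnor.ThetaV0 (RelMilnor.zeroSet Φ)) =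
      RelMilnor.J (RelMilnor.polyGerm g) (RelMilnor.ThetaV0 (RelMilnor.zeroSet Φ))) :
    RelMilnor.RVEquiv (RelMilnor.zeroSet Φ) (RelMilnor.polyFun f) (RelMilnor.polyFun g) :=
  RelMilnor.rvEquiv_of_J_eq hw hf hg hΦ hJ
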